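/- Let $X\subseteq\mathbb R^n$ be open, let $U\subseteq\mathbb R^{n+1}$ be an open neighbourhood of $X\times\{0\}$, and let $U_+=U\cap\{(x,t): t>0\}$. Let $$L=\frac{\partial}{\partial t}+\sum_{j=1}^n a_j(x,t)\frac{\partial}{\partial x_j},$$ where the complex-valued coefficients $a_j$ are $C^\infty$ on $(X\times\{0\})\cup U_+$. Let $f\in L^1_{\mathrm{loc}}(U_+)$ be such that (i) $Lf\in L^1(U_+)$, where $Lf$ is taken in the sense of distributions; (ii) for every compact $K\subset X$ there are $N=N(K)\in\mathbb N$, $C=C(K)$ and $\delta=\delta(K)>0$ such that $$\int_K |f(x,t)|\,dx\le \frac{C}{t^{N}}\quad\text{for almost every } t\in(0,\delta).$$ For $t>0$ put $U_t=\{x:(x,t)\in U_+\}$. Then there is a unique family of distributions $f(\cdot,t)\in\mathcal D'(U_t)$, $t>0$ (the traces of $f$), such that $t\mapsto\langle f(\cdot,t),\varphi\rangle$ is continuous on $\{t>0:\operatorname{supp}\varphi\subset U_t\}$ for every $\varphi\in C_c^\infty(\mathbb R^n)$, and such that for almost every $t>0$ the function $x\mapsto f(x,t)$ is locally integrable on $U_t$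 and is equal, as a distribution, to $f(\cdot,t)$. Moreover, the limit $bf=\lim_{t\to0^+}f(\cdot,t)$ exists in $\mathcal D'(X)$: there is $bf\in\mathcal D'(X)$ with $$\lim_{t\to0^+}\langle f(\cdot,t),\varphi\rangle=\langle bf,\varphi\rangle\quad\text{for every }\varphi\in C_c^\infty(X)$$ (the support of $\varphi$ is contained in $U_t$ for all small $t>0$). Furthermore, if $T>0$ and $X\times(0,T]\subseteq U_+$, then the distributions $\{f(\cdot,t):0\le t\le T\}$, where $f(\cdot,0)=bf$, are uniformly bounded in $\mathcal D'(X)$: for every compact $K\subset X$ there are $m\in\mathbb N$ and $C'>0$ such that $$|\langle f(\cdot,t),\varphi\rangle|\le C'\sum_{i\le m}\ \sup_{x}|D^i\varphi(x)|\quad\text{for all } t\in[0,T] \text{ and all } \varphi\in C_c^\infty(X) \text{ with } \operatorname{supp}\varphi\subseteq K .$$ -/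

import Mathlib

open Set Filter Topology MeasureTheory TopologicalSpace
open scoped ContDiff Distributions ENNReal

/-- `ℝⁿ`. -/
abbrev Rn (n : ℕ) : Type := EuclideanSpace ℝ (Fin n)

namespace Trace

/-- `U₊ = U ∩ {t > 0}` for an open set `U` of `ℝⁿ × ℝ = ℝⁿ⁺¹`. -/
def upperPart {n : ℕ} (U : Opens (Rn n × ℝ)) : Opens (Rn n × ℝ) :=
  U ⊓ ⟨{z | 0 < z.2}, isOpen_lt continuous_const continuous_snd⟩

/-- The slice `{x : (x, t) ∈ Ω}` of an open set `Ω ⊆ ℝⁿ × ℝ`. -/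
def slice {n : ℕ} (Ω : Opens (Rn n × ℝ)) (t : ℝ) : Opens (Rn n) :=
  ⟨{x | (x, t) ∈ Ω}, Ω.isOpen.preimage (by fun_prop : Continuous fun x : Rn n => (x, t))⟩

/-- The formal transpose of `L = ∂/∂t + ∑ⱼ aⱼ ∂/∂xⱼ` applied to `Φ`:
`ᵗLΦ = -∂Φ/∂t - ∑ⱼ ∂(aⱼ Φ)/∂xⱼ`. -/
noncomputable def transpose {n : ℕ} (a : Fin n → Rn n × ℝ → ℂ) (Φ : Rn n × ℝ → ℂ)
    (z : Rn n × ℝ) : ℂ :=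
  -(fderiv ℝ Φ z (0, 1)) -
    ∑ j, fderiv ℝ (fun w => a j w * Φ w) z (EuclideanSpace.single j 1, 0)

/-- `Lf = g` in the sense of distributions on the open set `Ω`, where
`L = ∂/∂t + ∑ⱼ aⱼ ∂/∂xⱼ` and `f`, `g` are locally integrable on `Ω`. -/
def SolvesWeakly {n : ℕ} (a : Fin n → Rn n × ℝ → ℂ) (Ω : Opens (Rn n × ℝ))
    (f g : Rn n × ℝ → ℂ) : Prop :=
  ∀ Φ : 𝓓(Ω, ℂ), ∫ z in (Ω : Set (Rn n × ℝ)), f z * transpose a Φ z =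
    ∫ z in (Ω : Set (Rn n × ℝ)), g z * Φ z

open scoped Classical in
/-- The value at `φ ∈ C_c^∞(V)` of a distribution `S` on another open set `W`; it is meaningful
when `supp φ ⊆ W`, and is set to be `0` otherwise. -/
noncomputable def pair {n : ℕ} {V W : Opens (Rn n)} (S : 𝓓'(W, ℂ)) (φ : 𝓓(V, ℝ)) : ℂ :=
  if h : tsupport φ ⊆ W then S ⟨φ, φ.contDiff, φ.hasCompactSupport, h⟩ else 0

/-- `F` is the family of traces `F t = f(·, t)` of the locally integrable function `f` on `Ω`:
`F t` is a distribution on the slice of `Ω` at height `t`; it depends continuously on `t` (that is,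
`t ↦ ⟨F t, φ⟩` is continuous on the set of those `t` for which `φ` is a test function on the slice);
and for almost every `t` it is the locally integrable function `x ↦ f (x, t)`. -/
structure IsTrace {n : ℕ} (Ω : Opens (Rn n × ℝ)) (f : Rn n × ℝ → ℂ)
    (F : (t : ℝ) → 𝓓'(slice Ω t, ℂ)) : Prop where
  continuousOn : ∀ φ : 𝓓((⊤ : Opens (Rn n)), ℝ),
    ContinuousOn (fun t => pair (F t) φ) {t | tsupport φ ⊆ slice Ω t}
  ae_eq : ∀ᵐ t : ℝ,
    LocallyIntegrableOn (fun x => f (x, t)) (slice Ω t : Set (Rn n)) ∧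
    ∀ φ : 𝓓(slice Ω t, ℝ),
      F t φ = ∫ x in (slice Ω t : Set (Rn n)), f (x, t) * (φ x : ℂ)

/-- The restriction to `V` of a distribution on `W`, for open sets `V ⊆ W`. -/
noncomputable def restrict {n : ℕ} {V W : Opens (Rn n)} (_h : V ≤ W) (S : 𝓓'(W, ℂ)) : 𝓓'(V, ℂ) :=
  (TestFunction.monoCLM ℝ : 𝓓(V, ℝ) →L[ℝ] 𝓓(W, ℝ)).precompCompactConvergenceCLM ℂ S

/-- The set `B` of distributions on `X` is uniformly bounded in `𝓓'(X)`: on every compact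
`K ⊆ X`, its elements satisfy one common estimate
`|⟨S, φ⟩| ≤ C ∑_{i ≤ m} sup |Dⁱφ|`, `φ ∈ C_c^∞(K)`. -/
def UniformlyBounded {n : ℕ} {X : Opens (Rn n)} (B : Set 𝓓'(X, ℂ)) : Prop :=
  ∀ K : Set (Rn n), IsCompact K → K ⊆ X → ∃ (m : ℕ) (C : ℝ), ∀ S ∈ B, ∀ φ : 𝓓(X, ℝ),
    tsupport φ ⊆ K →
      ‖S φ‖ ≤ C * ∑ i ∈ Finset.range (m + 1), ⨆ x, ‖iteratedFDeriv ℝ i φ x‖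

end Trace

/-!
The idea is to test the equation against functions `ψ(t) u(x, t)`. If `u` is smooth and vanishes
outside a compact set of `x` and for large `t`, then `H(t) = ∫ f u dx` has the weak derivative
`-∫ (f ᵗLu - g u) dx`, so that almost everywhere
`H(t) = ∫_t^β ∫ (f ᵗLu - g u) dx ds` (`ae_integral_eq_tail_of_solvesWeakly`). With `u = φ(x) χ(t)`
and a cutoff `χ` equal to `1` near the time in question, the left-hand side is `⟨f(·, t), φ⟩`, while
the right-hand side is continuous in `t` and bounded by the `C¹` norm of `φ`. This gives the traces
at positive times. They are encoded as limits of `s ↦ ∫ f(x, s) φ(x) dx` along the filter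
`ae volume ⊓ 𝓝 t`, which makes linearity and uniqueness immediate. That almost every slice of `f`
is the trace, for all test functions at once, follows from the separability of `C¹` on compact sets.

At the boundary, the formula is iterated with `u`, `ᵗLu`, …, `(ᵗL)^{N+1} u`, where `N` is the order
of growth of `f` as `t → 0⁺`. By Fubini's theorem the iterated integrals collapse to
`⟨f(·, t), φ⟩ = ∫_t^β (s - t)^N / N! ∫ f (ᵗL)^{N+1} u dx ds
  - ∑_{j ≤ N} ∫_t^β (s - t)^j / j! ∫ g (ᵗL)^j u dx ds`
(`integral_eq_taylor_expansion`). The weight `(s - t)^N` compensates the growth `s^{-N}` of the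
slices of `f`, and `g` is integrable up to `t = 0`, so by dominated convergence the right-hand side
has a limit as `t → 0⁺` and is bounded by the `C^{N+1}` norm of `φ`
(`exists_boundary_representation`). The smoothness of the coefficients up to `t = 0` enters through
the boundedness of `(ᵗL)^j u` on compact sets; there derivatives are taken within
`X × {0} ∪ U₊`, which is a set of unique differentiability. The uniform bounds near `0` and near each
positive time combine by compactness of `[0, T]`.
-/

namespace Trace

/-! ### Jets and the transpose up to the boundary -/

section

section Calculus

variable {E : Type*} [NormedAddCommGroup E] [NormedSpace ℝ E]

/-- The size of the `m`-jet of `u` relative to `S` at the point `z`: the sum of the norms of the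
derivatives within `S` of order at most `m`. -/
noncomputable def jetNorm (S : Set E) (m : ℕ) (u : E → ℂ) (z : E) : ℝ :=
  ∑ i ∈ Finset.range (m + 1), ‖iteratedFDerivWithin ℝ i u S z‖

lemma norm_iteratedFDerivWithin_le_jetNorm {S : Set E} {m i : ℕ} (hi : i ≤ m) (u : E → ℂ) (z : E) :
    ‖iteratedFDerivWithin ℝ i u S z‖ ≤ jetNorm S m u z :=
  Finset.single_le_sum (f := fun i => ‖iteratedFDerivWithin ℝ i u S z‖)
    (fun _ _ => norm_nonneg _) (Finset.mem_range.2 (Nat.lt_succ_of_le hi))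

lemma continuousOn_jetNorm {S : Set E} (hS : UniqueDiffOn ℝ S) {u : E → ℂ}
    (hu : ContDiffOn ℝ ∞ u S) (m : ℕ) : ContinuousOn (jetNorm S m u) S :=
  continuousOn_finsetSum _ fun i _ =>
    (hu.continuousOn_iteratedFDerivWithin (by exact_mod_cast le_top) hS).norm

/-- Leibniz rule: multiplication by a function smooth up to the boundary is bounded on `m`-jets,
uniformly over a compact set. -/
lemma exists_jetNorm_mul_le {S : Set E} (hS : UniqueDiffOn ℝ S) {b : E → ℂ}
    (hb : ContDiffOn ℝ ∞ b S) {K : Set E} (hK : IsCompact K) (hKS : K ⊆ S) (m : ℕ) :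
    ∃ C, 0 ≤ C ∧ ∀ u : E → ℂ, ContDiffOn ℝ ∞ u S → ∀ z ∈ K,
      jetNorm S m (fun w => b w * u w) z ≤ C * jetNorm S m u z := by
  obtain ⟨A, hA⟩ := hK.exists_bound_of_continuousOn ((continuousOn_jetNorm hS hb m).mono hKS)
  refine ⟨∑ i ∈ Finset.range (m + 1), ∑ k ∈ Finset.range (i + 1), (i.choose k : ℝ) * |A|,
    by positivity, fun u hu z hz => ?_⟩
  rw [jetNorm, Finset.sum_mul]
  refine Finset.sum_le_sum fun i hi => ?_
  have him : i ≤ m := Nat.lt_succ_iff.1 (Finset.mem_range.1 hi)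
  refine (norm_iteratedFDerivWithin_mul_le hb hu hS (hKS hz) (n := i)
    (by exact_mod_cast le_top)).trans ?_
  rw [Finset.sum_mul]
  refine Finset.sum_le_sum fun k hk => ?_
  have hki : k ≤ i := Nat.lt_succ_iff.1 (Finset.mem_range.1 hk)
  have h1 : ‖iteratedFDerivWithin ℝ k b S z‖ ≤ |A| :=
    (norm_iteratedFDerivWithin_le_jetNorm (hki.trans him) b z).trans
      ((le_abs_self _).trans ((hA z hz).trans (le_abs_self _)))
  have h2 : ‖iteratedFDerivWithin ℝ (i - k) u S z‖ ≤ jetNorm S m u z :=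
    norm_iteratedFDerivWithin_le_jetNorm ((Nat.sub_le _ _).trans him) u z
  gcongr

lemma contDiffOn_fderivWithin_apply {S : Set E} (hS : UniqueDiffOn ℝ S) {u : E → ℂ}
    (hu : ContDiffOn ℝ ∞ u S) (v : E) :
    ContDiffOn ℝ ∞ (fun z => fderivWithin ℝ u S z v) S :=
  (hu.fderivWithin hS (by simp)).clm_apply contDiffOn_const

lemma jetNorm_fderivWithin_apply_le {S : Set E} (hS : UniqueDiffOn ℝ S) {u : E → ℂ}
    (hu : ContDiffOn ℝ ∞ u S) (v : E) (m : ℕ) {z : E} (hz : z ∈ S) :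
    jetNorm S m (fun w => fderivWithin ℝ u S w v) z ≤ ‖v‖ * jetNorm S (m + 1) u z := by
  have h : ∀ i, ‖iteratedFDerivWithin ℝ i (fun w => fderivWithin ℝ u S w v) S z‖ ≤
      ‖v‖ * ‖iteratedFDerivWithin ℝ (i + 1) u S z‖ := fun i => by
    rw [← norm_iteratedFDerivWithin_fderivWithin hS hz]
    exact norm_iteratedFDerivWithin_clm_apply_const
      ((hu.fderivWithin (n := ∞) (m := ∞) hS (by simp)) z hz) hS hz (by exact_mod_cast le_top)
  rw [jetNorm, jetNorm, Finset.sum_range_succ' _ (m + 1), mul_add, Finset.mul_sum]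
  exact (Finset.sum_le_sum fun i _ => h i).trans (le_add_of_nonneg_right (by positivity))

lemma jetNorm_neg_sub_sum_le {S : Set E} (hS : UniqueDiffOn ℝ S) {ι : Type*} (s : Finset ι)
    {u : E → ℂ} {v : ι → E → ℂ} (hu : ContDiffOn ℝ ∞ u S) (hv : ∀ j, ContDiffOn ℝ ∞ (v j) S)
    (m : ℕ) {z : E} (hz : z ∈ S) :
    jetNorm S m (fun w => -u w - ∑ j ∈ s, v j w) z ≤
      jetNorm S m u z + ∑ j ∈ s, jetNorm S m (v j) z := by
  simp only [jetNorm]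
  rw [Finset.sum_comm, ← Finset.sum_add_distrib]
  refine Finset.sum_le_sum fun i _ => ?_
  have hi : ((i : ℕ) : ℕ∞ω) ≤ (∞ : ℕ∞ω) := by exact_mod_cast le_top
  have h1 : iteratedFDerivWithin ℝ i (fun w => -u w - ∑ j ∈ s, v j w) S z =
      -iteratedFDerivWithin ℝ i u S z - ∑ j ∈ s, iteratedFDerivWithin ℝ i (v j) S z := by
    have hsum : ContDiffOn ℝ ∞ (fun w => ∑ j ∈ s, v j w) S := ContDiffOn.sum fun j _ => hv j
    rw [← iteratedFDerivWithin_neg_apply hS hz,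
      ← iteratedFDerivWithin_fun_sum_apply hS hz fun j _ => (hv j z hz).of_le hi]
    exact iteratedFDerivWithin_sub_apply ((hu.neg z hz).of_le hi) ((hsum z hz).of_le hi) hS hz
  rw [h1]
  refine (norm_sub_le _ _).trans ?_
  rw [norm_neg]
  gcongr
  exact norm_sum_le _ _

end Calculus

variable {n : ℕ}

/-- The transpose of `L` formed with derivatives within `S`. On the open part of `S` it is
`transpose`; taking derivatives within `S` keeps it meaningful, and iterable, at the boundary points
of `S`. -/
noncomputable def transposeWithin (S : Set (Rn n × ℝ)) (a : Fin n → Rn n × ℝ → ℂ)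
    (u : Rn n × ℝ → ℂ) (z : Rn n × ℝ) : ℂ :=
  -(fderivWithin ℝ u S z (0, 1)) -
    ∑ j, fderivWithin ℝ (fun w => a j w * u w) S z (EuclideanSpace.single j 1, 0)

section

variable {S : Set (Rn n × ℝ)} {a : Fin n → Rn n × ℝ → ℂ} {u : Rn n × ℝ → ℂ}

lemma transposeWithin_eq_transpose {z : Rn n × ℝ} (hz : S ∈ 𝓝 z) :
    transposeWithin S a u z = transpose a u z := by
  simp only [transposeWithin, transpose, fderivWithin_of_mem_nhds hz]

lemma contDiffOn_transposeWithin (hS : UniqueDiffOn ℝ S) (ha : ∀ j, ContDiffOn ℝ ∞ (a j) S)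
    (hu : ContDiffOn ℝ ∞ u S) : ContDiffOn ℝ ∞ (transposeWithin S a u) S :=
  (contDiffOn_fderivWithin_apply hS hu _).neg.sub
    (ContDiffOn.sum fun j _ => contDiffOn_fderivWithin_apply hS ((ha j).mul hu) _)

/-- The transpose is local: it does not enlarge supports. -/
lemma transposeWithin_eqOn_zero {C : Set (Rn n × ℝ)} (hC : IsClosed C)
    (hu : ∀ z ∈ S, z ∉ C → u z = 0) : ∀ z ∈ S, z ∉ C → transposeWithin S a u z = 0 := by
  intro z hz hzC
  have h : u =ᶠ[𝓝[S] z] fun _ => 0 := by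
    filter_upwards [self_mem_nhdsWithin, mem_nhdsWithin_of_mem_nhds (hC.isOpen_compl.mem_nhds hzC)]
      with w hw hwC using hu w hw hwC
  have h' : ∀ j, (fun w => a j w * u w) =ᶠ[𝓝[S] z] fun _ => 0 := fun j => by
    filter_upwards [h] with w hw
    simp [hw]
  have h2 : ∀ j, fderivWithin ℝ (fun w => a j w * u w) S z = 0 := fun j => by
    rw [(h' j).fderivWithin_eq_of_mem hz]
    simp
  simp [transposeWithin, h.fderivWithin_eq_of_mem hz, h2]

lemma contDiffOn_iterate_transposeWithin (hS : UniqueDiffOn ℝ S)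
    (ha : ∀ j, ContDiffOn ℝ ∞ (a j) S) (hu : ContDiffOn ℝ ∞ u S) (k : ℕ) :
    ContDiffOn ℝ ∞ ((transposeWithin S a)^[k] u) S := by
  induction k with
  | zero => exact hu
  | succ k ih =>
    rw [Function.iterate_succ_apply']
    exact contDiffOn_transposeWithin hS ha ih

lemma iterate_transposeWithin_eqOn_zero {C : Set (Rn n × ℝ)} (hC : IsClosed C)
    (hu : ∀ z ∈ S, z ∉ C → u z = 0) (k : ℕ) :
    ∀ z ∈ S, z ∉ C → (transposeWithin S a)^[k] u z = 0 := by
  induction k with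
  | zero => exact hu
  | succ k ih =>
    rw [Function.iterate_succ_apply']
    exact transposeWithin_eqOn_zero hC ih

lemma exists_jetNorm_transposeWithin_le (hS : UniqueDiffOn ℝ S)
    (ha : ∀ j, ContDiffOn ℝ ∞ (a j) S) {K : Set (Rn n × ℝ)} (hK : IsCompact K) (hKS : K ⊆ S)
    (m : ℕ) : ∃ C, 0 ≤ C ∧ ∀ u : Rn n × ℝ → ℂ, ContDiffOn ℝ ∞ u S → ∀ z ∈ K,
      jetNorm S m (transposeWithin S a u) z ≤ C * jetNorm S (m + 1) u z := by
  choose C hC0 hC using fun j => exists_jetNorm_mul_le hS (ha j) hK hKS (m + 1)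
  refine ⟨‖((0 : Rn n), (1 : ℝ))‖ +
    ∑ j, ‖(EuclideanSpace.single j (1 : ℝ), (0 : ℝ))‖ * C j,
    add_nonneg (norm_nonneg _) (Finset.sum_nonneg fun j _ => mul_nonneg (norm_nonneg _) (hC0 j)),
    fun u hu z hz => ?_⟩
  refine (jetNorm_neg_sub_sum_le hS Finset.univ
    (contDiffOn_fderivWithin_apply hS hu _)
    (fun j => contDiffOn_fderivWithin_apply hS ((ha j).mul hu) _) m (hKS hz)).trans ?_
  rw [add_mul, Finset.sum_mul]
  refine add_le_add (jetNorm_fderivWithin_apply_le hS hu _ m (hKS hz))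
    (Finset.sum_le_sum fun j _ => ?_)
  refine (jetNorm_fderivWithin_apply_le hS ((ha j).mul hu) _ m (hKS hz)).trans ?_
  rw [mul_assoc]
  gcongr
  exact hC j u hu z hz

lemma exists_norm_iterate_transposeWithin_le (hS : UniqueDiffOn ℝ S)
    (ha : ∀ j, ContDiffOn ℝ ∞ (a j) S) {K : Set (Rn n × ℝ)} (hK : IsCompact K) (hKS : K ⊆ S)
    (k : ℕ) : ∃ C, 0 ≤ C ∧ ∀ u : Rn n × ℝ → ℂ, ContDiffOn ℝ ∞ u S → ∀ z ∈ K,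
      ‖(transposeWithin S a)^[k] u z‖ ≤ C * jetNorm S k u z := by
  induction k with
  | zero =>
    refine ⟨1, zero_le_one, fun u _ z _ => ?_⟩
    simp [jetNorm]
  | succ k ih =>
    obtain ⟨C, hC0, hC⟩ := ih
    obtain ⟨D, hD0, hD⟩ := exists_jetNorm_transposeWithin_le hS ha hK hKS k
    refine ⟨C * D, by positivity, fun u hu z hz => ?_⟩
    rw [Function.iterate_succ_apply]
    refine (hC _ (contDiffOn_transposeWithin hS ha hu) z hz).trans ?_
    rw [mul_assoc]
    gcongr
    exact hD u hu z hz

end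

/-- The norm `∑_{i ≤ m} sup |Dⁱφ|`. For functions without bounded derivatives the suprema are junk
values; it is only used for compactly supported smooth `φ`. -/
noncomputable def testNorm (m : ℕ) (φ : Rn n → ℝ) : ℝ :=
  ∑ i ∈ Finset.range (m + 1), ⨆ x, ‖iteratedFDeriv ℝ i φ x‖

lemma testNorm_nonneg (m : ℕ) (φ : Rn n → ℝ) : 0 ≤ testNorm m φ :=
  Finset.sum_nonneg fun _ _ => Real.iSup_nonneg fun _ => norm_nonneg _

lemma testNorm_mono {m k : ℕ} (h : m ≤ k) (φ : Rn n → ℝ) : testNorm m φ ≤ testNorm k φ :=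
  Finset.sum_le_sum_of_subset_of_nonneg (Finset.range_mono (by omega))
    fun _ _ _ => Real.iSup_nonneg fun _ => norm_nonneg _

lemma norm_iteratedFDeriv_le_iSup {φ : Rn n → ℝ} (hφ : ContDiff ℝ ∞ φ)
    (hc : HasCompactSupport φ) (i : ℕ) (x : Rn n) :
    ‖iteratedFDeriv ℝ i φ x‖ ≤ ⨆ x, ‖iteratedFDeriv ℝ i φ x‖ := by
  obtain ⟨C, hC⟩ := (hφ.continuous_iteratedFDeriv (m := i)
    (by exact_mod_cast le_top)).bounded_above_of_compact_support (hc.iteratedFDeriv i)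
  exact le_ciSup (f := fun x => ‖iteratedFDeriv ℝ i φ x‖) ⟨C, by rintro _ ⟨y, rfl⟩; exact hC y⟩ x

/-- The tensor product `φ(x) χ(t)`, as a complex-valued function of `(x, t)`. -/
def tensor (φ : Rn n → ℝ) (χ : ℝ → ℝ) (z : Rn n × ℝ) : ℂ := (χ z.2 : ℂ) * (φ z.1 : ℂ)

lemma contDiff_tensor {φ : Rn n → ℝ} {χ : ℝ → ℝ} (hφ : ContDiff ℝ ∞ φ) (hχ : ContDiff ℝ ∞ χ) :
    ContDiff ℝ ∞ (tensor φ χ) :=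
  (Complex.ofRealCLM.contDiff.comp (hχ.comp contDiff_snd)).mul
    (Complex.ofRealCLM.contDiff.comp (hφ.comp contDiff_fst))

lemma exists_jetNorm_tensor_le {S : Set (Rn n × ℝ)} (hS : UniqueDiffOn ℝ S)
    {K : Set (Rn n × ℝ)} (hK : IsCompact K) (hKS : K ⊆ S) {χ : ℝ → ℝ} (hχ : ContDiff ℝ ∞ χ)
    (m : ℕ) : ∃ C, 0 ≤ C ∧ ∀ φ : Rn n → ℝ, ContDiff ℝ ∞ φ → HasCompactSupport φ → ∀ z ∈ K,
      jetNorm S m (tensor φ χ) z ≤ C * testNorm m φ := by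
  obtain ⟨C, hC0, hC⟩ := exists_jetNorm_mul_le hS
    (b := fun z : Rn n × ℝ => (χ z.2 : ℂ))
    (Complex.ofRealCLM.contDiff.comp (hχ.comp contDiff_snd)).contDiffOn hK hKS m
  refine ⟨C, hC0, fun φ hφ hc z hz => ?_⟩
  have hΦ : ContDiff ℝ ∞ (fun z : Rn n × ℝ => (φ z.1 : ℂ)) :=
    Complex.ofRealCLM.contDiff.comp (hφ.comp contDiff_fst)
  refine (hC _ hΦ.contDiffOn z hz).trans ?_
  gcongr
  refine Finset.sum_le_sum fun i _ => ?_
  have hi : ((i : ℕ) : ℕ∞ω) ≤ (∞ : ℕ∞ω) := by exact_mod_cast le_top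
  rw [iteratedFDerivWithin_eq_iteratedFDeriv hS (hΦ.contDiffAt.of_le hi) (hKS hz)]
  have h1 : ‖iteratedFDeriv ℝ i (fun z : Rn n × ℝ => (φ z.1 : ℂ)) z‖ =
      ‖iteratedFDeriv ℝ i (fun z : Rn n × ℝ => φ z.1) z‖ :=
    Complex.ofRealLI.norm_iteratedFDeriv_comp_left (f := fun z : Rn n × ℝ => φ z.1)
      (hφ.comp contDiff_fst).contDiffAt hi
  have h2 : iteratedFDeriv ℝ i (fun z : Rn n × ℝ => φ z.1) z =
      (iteratedFDeriv ℝ i φ z.1).compContinuousLinearMap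
        (fun _ => ContinuousLinearMap.fst ℝ (Rn n) ℝ) :=
    (ContinuousLinearMap.fst ℝ (Rn n) ℝ).iteratedFDeriv_comp_right hφ z hi
  rw [h1, h2]
  refine (ContinuousMultilinearMap.norm_compContinuousLinearMap_le _ _).trans ?_
  refine le_trans ?_ (norm_iteratedFDeriv_le_iSup hφ hc i z.1)
  refine mul_le_of_le_one_right (norm_nonneg _) (Finset.prod_le_one (fun _ _ => norm_nonneg _)
    fun _ _ => ContinuousLinearMap.norm_fst_le _ _ _)

/-- The `k`-th iterate of the transpose is a differential operator of order `k` whose coefficients are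
bounded on compact subsets of `S`, boundary points included. -/
lemma exists_norm_iterate_transposeWithin_tensor_le {S : Set (Rn n × ℝ)} (hS : UniqueDiffOn ℝ S)
    {a : Fin n → Rn n × ℝ → ℂ} (ha : ∀ j, ContDiffOn ℝ ∞ (a j) S)
    {K : Set (Rn n × ℝ)} (hK : IsCompact K) (hKS : K ⊆ S) {χ : ℝ → ℝ} (hχ : ContDiff ℝ ∞ χ)
    (k : ℕ) : ∃ C, 0 ≤ C ∧ ∀ φ : Rn n → ℝ, ContDiff ℝ ∞ φ → HasCompactSupport φ → ∀ z ∈ K,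
      ‖(transposeWithin S a)^[k] (tensor φ χ) z‖ ≤ C * testNorm k φ := by
  obtain ⟨C, hC0, hC⟩ := exists_norm_iterate_transposeWithin_le hS ha hK hKS k
  obtain ⟨D, hD0, hD⟩ := exists_jetNorm_tensor_le hS hK hKS hχ k
  refine ⟨C * D, by positivity, fun φ hφ hc z hz => ?_⟩
  refine (hC _ (contDiff_tensor hφ hχ).contDiffOn z hz).trans ?_
  rw [mul_assoc]
  gcongr
  exact hD φ hφ hc z hz

/-- Near a point of `X × {0}` the set contains a relative neighbourhood in the closed half space
`t ≥ 0`, so derivatives within it are unique. -/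
lemma uniqueDiffOn_union_upperPart (X : Opens (Rn n)) (U : Opens (Rn n × ℝ))
    (hXU : ∀ x ∈ X, (x, (0 : ℝ)) ∈ U) :
    UniqueDiffOn ℝ ((X : Set (Rn n)) ×ˢ {(0 : ℝ)} ∪ (upperPart U : Set (Rn n × ℝ))) := by
  rintro ⟨x, t⟩ (⟨hx, ht⟩ | hz)
  · obtain rfl : t = 0 := ht
    have hU : (U : Set (Rn n × ℝ)) ∈ 𝓝 (x, (0 : ℝ)) := U.isOpen.mem_nhds (hXU x hx)
    have hX : (X : Set (Rn n)) ∈ 𝓝 x := X.isOpen.mem_nhds hx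
    have h : UniqueDiffWithinAt ℝ ((univ : Set (Rn n)) ×ˢ Ici (0 : ℝ)) (x, 0) :=
      uniqueDiffWithinAt_univ.prod (uniqueDiffOn_Ici 0 0 self_mem_Ici)
    refine (h.inter (inter_mem hU (prod_mem_nhds hX univ_mem))).mono ?_
    rintro ⟨y, s⟩ ⟨⟨-, hs⟩, hyU, hyX, -⟩
    rcases eq_or_lt_of_le (show (0 : ℝ) ≤ s from hs) with rfl | hs
    · exact Or.inl ⟨hyX, rfl⟩
    · exact Or.inr ⟨hyU, hs⟩
  · exact ((upperPart U).isOpen.uniqueDiffWithinAt hz).mono subset_union_right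

end

/-! ### Iterated integration on an interval -/

section

/-- Fubini's theorem on the triangle `α < t < s ≤ β`. -/
lemma integral_mul_integral_tail {w v : ℝ → ℂ} {α β : ℝ} (hαβ : α ≤ β)
    (hw : IntervalIntegrable w volume α β) (hv : IntervalIntegrable v volume α β) :
    ∫ t in α..β, w t * ∫ s in t..β, v s = ∫ s in α..β, (∫ t in α..s, w t) * v s := by
  rw [intervalIntegrable_iff_integrableOn_Ioc_of_le hαβ] at hw hv
  have hI : Integrable (Function.uncurry fun t s : ℝ =>
      {p : ℝ × ℝ | p.1 < p.2}.indicator (fun p => w p.1 * v p.2) (t, s))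
      ((volume.restrict (Ioc α β)).prod (volume.restrict (Ioc α β))) :=
    (hw.mul_prod hv).indicator (measurableSet_lt measurable_fst measurable_snd)
  have hswap := integral_integral_swap hI
  rw [intervalIntegral.integral_of_le hαβ, intervalIntegral.integral_of_le hαβ]
  refine Eq.trans (setIntegral_congr_fun measurableSet_Ioc fun t ht => ?_)
    (hswap.trans (setIntegral_congr_fun measurableSet_Ioc fun s hs => ?_))
  · have e : (fun s => {p : ℝ × ℝ | p.1 < p.2}.indicator (fun p => w p.1 * v p.2) (t, s)) =
        (Ioi t).indicator fun s => w t * v s := by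
      ext s; simp [indicator_apply]
    simp only [e]
    rw [setIntegral_indicator measurableSet_Ioi, Ioc_inter_Ioi, sup_eq_right.2 ht.1.le,
      intervalIntegral.integral_of_le ht.2, integral_const_mul]
  · have e : (fun t => {p : ℝ × ℝ | p.1 < p.2}.indicator (fun p => w p.1 * v p.2) (t, s)) =
        (Iio s).indicator fun t => w t * v s := by
      ext t; simp [indicator_apply]
    have e2 : Ioc α β ∩ Iio s = Ioo α s := by
      ext t
      simp only [mem_inter_iff, mem_Ioc, mem_Iio, mem_Ioo]
      exact ⟨fun h => ⟨h.1.1, h.2⟩, fun h => ⟨⟨h.1, h.2.le.trans hs.2⟩, h.2⟩⟩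
    simp only [e]
    rw [setIntegral_indicator measurableSet_Iio, e2, ← integral_Ioc_eq_integral_Ioo,
      intervalIntegral.integral_of_le hs.1.le, integral_mul_const]

/-- The kernel `(s - t)^N / N!` of the `(N + 1)`-fold iterated integral. -/
noncomputable def taylorWeight (N : ℕ) (t s : ℝ) : ℝ := (s - t) ^ N / (N.factorial : ℝ)

lemma taylorWeight_zero (t s : ℝ) : taylorWeight 0 t s = 1 := by simp [taylorWeight]

lemma continuous_taylorWeight (N : ℕ) (t : ℝ) : Continuous (taylorWeight N t) := by
  unfold taylorWeight; fun_prop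

lemma integral_taylorWeight (N : ℕ) (t s : ℝ) :
    ∫ r in t..s, (taylorWeight N t r : ℂ) = (taylorWeight (N + 1) t s : ℂ) := by
  rw [intervalIntegral.integral_ofReal]
  congr 1
  unfold taylorWeight
  rw [intervalIntegral.integral_comp_sub_right (fun x => x ^ N / (N.factorial : ℝ)),
    intervalIntegral.integral_div, integral_pow, Nat.factorial_succ]
  push_cast
  have : (N.factorial : ℝ) ≠ 0 := by positivity
  field_simp
  simp

lemma norm_taylorWeight_le {N : ℕ} {t s : ℝ} (ht : 0 ≤ t) (hts : t ≤ s) :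
    ‖(taylorWeight N t s : ℂ)‖ ≤ s ^ N := by
  rw [Complex.norm_real, taylorWeight, norm_div, norm_pow, Real.norm_of_nonneg (sub_nonneg.2 hts),
    RCLike.norm_natCast]
  refine (div_le_self (by have := sub_nonneg.2 hts; positivity)
    (by exact_mod_cast N.factorial_pos)).trans ?_
  exact pow_le_pow_left₀ (sub_nonneg.2 hts) (by linarith) N

lemma intervalIntegrable_taylorWeight_mul {w : ℝ → ℂ} {α β t : ℝ} (ht : t ∈ Icc α β)
    (hw : IntervalIntegrable w volume α β) (N : ℕ) :
    IntervalIntegrable (fun s => (taylorWeight N t s : ℂ) * w s) volume t β := by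
  refine (hw.mono_set ?_).continuousOn_mul
    (Complex.continuous_ofReal.comp (continuous_taylorWeight N t)).continuousOn
  rw [uIcc_of_le ht.2, uIcc_of_le (ht.1.trans ht.2)]
  exact Icc_subset_Icc_left ht.1

/-- If `H_j' = -(H_{j+1} - k_j)` and `H_j` vanishes at `β`, in integrated form and almost everywhere,
then iterating gives a Taylor formula in which only `H_{N+1}` occurs, with the weight
`(s - t)^N / N!`. The identity holds at every `t`, because the relations are only substituted under
the integral sign. -/
lemma integral_eq_taylor_expansion {α β : ℝ} {H k : ℕ → ℝ → ℂ}
    (hH : ∀ j, IntervalIntegrable (H j) volume α β) (hk : ∀ j, IntervalIntegrable (k j) volume α β)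
    (hrel : ∀ j, ∀ᵐ t : ℝ, t ∈ Ioo α β → H j t = ∫ s in t..β, (H (j + 1) s - k j s))
    (N : ℕ) {t : ℝ} (ht : t ∈ Icc α β) :
    ∫ s in t..β, (H 1 s - k 0 s) =
      (∫ s in t..β, (taylorWeight N t s : ℂ) * H (N + 1) s) -
        ∑ j ∈ Finset.range (N + 1), ∫ s in t..β, (taylorWeight j t s : ℂ) * k j s := by
  have hmono : ∀ {w : ℝ → ℂ}, IntervalIntegrable w volume α β → IntervalIntegrable w volume t β :=
    fun hw => hw.mono_set (by
      rw [uIcc_of_le ht.2, uIcc_of_le (ht.1.trans ht.2)]; exact Icc_subset_Icc_left ht.1)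
  induction N with
  | zero =>
    simp only [taylorWeight_zero, zero_add, Finset.range_one, Finset.sum_singleton,
      Complex.ofReal_one, one_mul]
    exact intervalIntegral.integral_sub (hmono (hH 1)) (hmono (hk 0))
  | succ N ih =>
    rw [ih, Finset.sum_range_succ _ (N + 1)]
    have h1 : ∫ s in t..β, (taylorWeight N t s : ℂ) * H (N + 1) s =
        ∫ s in t..β, (taylorWeight N t s : ℂ) * ∫ r in s..β, (H (N + 2) r - k (N + 1) r) := by
      refine intervalIntegral.integral_congr_ae ?_
      have hβ : ∀ᵐ s : ℝ, s ≠ β := by simp [ae_iff]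
      filter_upwards [hrel (N + 1), hβ] with s hs hsβ hsI
      rw [uIoc_of_le ht.2] at hsI
      rw [hs ⟨ht.1.trans_lt hsI.1, lt_of_le_of_ne hsI.2 hsβ⟩]
    rw [h1, integral_mul_integral_tail (w := fun s => (taylorWeight N t s : ℂ)) ht.2
      ((Complex.continuous_ofReal.comp (continuous_taylorWeight N t)).intervalIntegrable _ _)
      ((hmono (hH _)).sub (hmono (hk _)))]
    simp only [integral_taylorWeight, mul_sub]
    rw [intervalIntegral.integral_sub (intervalIntegrable_taylorWeight_mul ht (hH _) _)
      (intervalIntegrable_taylorWeight_mul ht (hk _) _)]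
    ring

lemma norm_integral_taylorWeight_mul_le {w : ℝ → ℂ} {β : ℝ} {N : ℕ}
    (hw : IntegrableOn (fun s => s ^ N * ‖w s‖) (Ioc 0 β)) {t : ℝ} (ht : t ∈ Ioc 0 β) :
    ‖∫ s in t..β, (taylorWeight N t s : ℂ) * w s‖ ≤ ∫ s in Ioc 0 β, s ^ N * ‖w s‖ := by
  rw [intervalIntegral.integral_of_le ht.2]
  have hsub : Ioc t β ⊆ Ioc 0 β := Ioc_subset_Ioc_left ht.1.le
  refine (norm_integral_le_of_norm_le (hw.mono_set hsub) ?_).trans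
    (setIntegral_mono_set hw ?_ hsub.eventuallyLE)
  · filter_upwards [ae_restrict_mem measurableSet_Ioc] with s hs
    rw [norm_mul]
    gcongr
    exact norm_taylorWeight_le ht.1.le hs.1.le
  · filter_upwards [ae_restrict_mem measurableSet_Ioc] with s hs
    have := hs.1.le
    positivity

/-- The weight `(s - t)^N` absorbs a singularity of order `s^{-N}` of `w` at `0`. -/
lemma tendsto_integral_taylorWeight_mul {w : ℝ → ℂ} {β : ℝ} (hβ : 0 < β) {N : ℕ}
    (hm : AEStronglyMeasurable w (volume.restrict (Ioc 0 β)))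
    (hw : IntegrableOn (fun s => s ^ N * ‖w s‖) (Ioc 0 β)) :
    Tendsto (fun t => ∫ s in t..β, (taylorWeight N t s : ℂ) * w s) (𝓝[>] 0)
      (𝓝 (∫ s in Ioc 0 β, (taylorWeight N 0 s : ℂ) * w s)) := by
  have key : Tendsto (fun t => ∫ s in Ioc 0 β,
      (Ioi t).indicator (fun s => (taylorWeight N t s : ℂ) * w s) s) (𝓝[>] 0)
      (𝓝 (∫ s in Ioc 0 β, (taylorWeight N 0 s : ℂ) * w s)) := by
    refine tendsto_integral_filter_of_dominated_convergence _ ?_ ?_ hw ?_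
    · refine Eventually.of_forall fun t => ?_
      exact ((Complex.continuous_ofReal.comp
        (continuous_taylorWeight N t)).aestronglyMeasurable.mul hm).indicator measurableSet_Ioi
    · filter_upwards [self_mem_nhdsWithin] with t ht
      filter_upwards [ae_restrict_mem measurableSet_Ioc] with s hs
      rw [indicator_apply]
      split_ifs with hts
      · rw [norm_mul]
        gcongr
        exact norm_taylorWeight_le (le_of_lt ht) (le_of_lt hts)
      · rw [norm_zero]
        have := hs.1.le
        positivity
    · filter_upwards [ae_restrict_mem measurableSet_Ioc] with s hs
      have h1 : Tendsto (fun t => (taylorWeight N t s : ℂ) * w s) (𝓝[>] 0)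
          (𝓝 ((taylorWeight N 0 s : ℂ) * w s)) := by
        have : Continuous fun t => (taylorWeight N t s : ℂ) * w s := by
          unfold taylorWeight; fun_prop
        exact (this.tendsto 0).mono_left nhdsWithin_le_nhds
      refine h1.congr' ?_
      filter_upwards [mem_nhdsWithin_of_mem_nhds (Iio_mem_nhds hs.1)] with t ht
      rw [indicator_of_mem (show s ∈ Ioi t from ht)]
  refine key.congr' ?_
  filter_upwards [Ioo_mem_nhdsGT hβ] with t ht
  rw [setIntegral_indicator measurableSet_Ioi, Ioc_inter_Ioi, sup_eq_right.2 ht.1.le,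
    intervalIntegral.integral_of_le ht.2.le]

end

/-! ### From the weak equation to slice integrals -/

section

section Box

variable {n : ℕ} {Ω : Opens (Rn n × ℝ)} {K : Set (Rn n)} {α β : ℝ} {f w : Rn n × ℝ → ℂ}

lemma integrable_mul_box (hf : LocallyIntegrableOn f (Ω : Set (Rn n × ℝ))) (hK : IsCompact K)
    (hbox : K ×ˢ Icc α β ⊆ (Ω : Set (Rn n × ℝ))) (hw : ContinuousOn w Ω) :
    Integrable (fun z => f z * w z) ((volume.restrict K).prod (volume.restrict (Ioc α β))) := by
  have hc : IsCompact (K ×ˢ Icc α β) := hK.prod isCompact_Icc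
  have h := (hf.integrableOn_compact_subset hbox hc).mul_continuousOn (hw.mono hbox) hc
  rw [Measure.prod_restrict]
  exact h.mono_set (prod_mono_right Ioc_subset_Icc_self)

lemma intervalIntegrable_integral_mul (hαβ : α ≤ β)
    (hf : LocallyIntegrableOn f (Ω : Set (Rn n × ℝ))) (hK : IsCompact K)
    (hbox : K ×ˢ Icc α β ⊆ (Ω : Set (Rn n × ℝ))) (hw : ContinuousOn w Ω) :
    IntervalIntegrable (fun t => ∫ x in K, f (x, t) * w (x, t)) volume α β := by
  rw [intervalIntegrable_iff_integrableOn_Ioc_of_le hαβ]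
  exact (integrable_mul_box hf hK hbox hw).integral_prod_right

end Box

section Primitive

variable {ψ : ℝ → ℝ} {α : ℝ}

lemma hasDerivAt_primitive (hψ : Continuous ψ) (α s : ℝ) :
    HasDerivAt (fun s => ∫ r in α..s, ψ r) (ψ s) s :=
  (hψ.integral_hasStrictDerivAt α s).hasDerivAt

lemma contDiff_primitive (hψ : ContDiff ℝ ∞ ψ) (α : ℝ) :
    ContDiff ℝ ∞ (fun s => ∫ r in α..s, ψ r) := by
  rw [contDiff_infty_iff_deriv]
  refine ⟨fun s => (hasDerivAt_primitive hψ.continuous α s).differentiableAt, ?_⟩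
  rwa [funext fun s => (hasDerivAt_primitive hψ.continuous α s).deriv]

lemma fderiv_primitive_mul {E : Type*} [NormedAddCommGroup E] [NormedSpace ℝ E]
    (hψ : Continuous ψ) (α : ℝ) {v : E × ℝ → ℂ} {z : E × ℝ}
    (hv : DifferentiableAt ℝ v z) (d : E × ℝ) :
    fderiv ℝ (fun w : E × ℝ => ((∫ r in α..w.2, ψ r : ℝ) : ℂ) * v w) z d =
      ((∫ r in α..z.2, ψ r : ℝ) : ℂ) * fderiv ℝ v z d + (d.2 * ψ z.2 : ℝ) * v z := by
  have h1 : HasFDerivAt (fun w : E × ℝ => ((∫ r in α..w.2, ψ r : ℝ) : ℂ))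
      (Complex.ofRealCLM.comp ((ContinuousLinearMap.toSpanSingleton ℝ (ψ z.2)).comp
        (ContinuousLinearMap.snd ℝ E ℝ))) z :=
    Complex.ofRealCLM.hasFDerivAt.comp z
      ((hasDerivAt_primitive hψ α z.2).hasFDerivAt.comp z hasFDerivAt_snd)
  rw [(h1.fun_mul hv.hasFDerivAt).fderiv]
  simp [mul_comm]

end Primitive

variable {n : ℕ} {Ω : Opens (Rn n × ℝ)} {a : Fin n → Rn n × ℝ → ℂ} {f g : Rn n × ℝ → ℂ}

lemma transpose_congr {u v : Rn n × ℝ → ℂ} {z : Rn n × ℝ} (h : u =ᶠ[𝓝 z] v) :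
    transpose a u z = transpose a v z := by
  have h' : ∀ j, (fun w => a j w * u w) =ᶠ[𝓝 z] fun w => a j w * v w := fun j => by
    filter_upwards [h] with w hw
    rw [hw]
  simp only [transpose, h.fderiv_eq, (h' _).fderiv_eq]

lemma transpose_primitive_mul (ha : ∀ j, ContDiffOn ℝ ∞ (a j) Ω) {ψ : ℝ → ℝ}
    (hψ : Continuous ψ) (α : ℝ) {u : Rn n × ℝ → ℂ} (hu : ContDiffOn ℝ ∞ u Ω) {z : Rn n × ℝ}
    (hz : z ∈ Ω) :
    transpose a (fun w => ((∫ r in α..w.2, ψ r : ℝ) : ℂ) * u w) z =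
      ((∫ r in α..z.2, ψ r : ℝ) : ℂ) * transpose a u z - ψ z.2 * u z := by
  have hΩ : (Ω : Set (Rn n × ℝ)) ∈ 𝓝 z := Ω.isOpen.mem_nhds hz
  have hud : DifferentiableAt ℝ u z := (hu.contDiffAt hΩ).differentiableAt (by simp)
  have had : ∀ j, DifferentiableAt ℝ (a j) z := fun j =>
    ((ha j).contDiffAt hΩ).differentiableAt (by simp)
  have h : ∀ j, fderiv ℝ (fun w => a j w * (((∫ r in α..w.2, ψ r : ℝ) : ℂ) * u w)) z
      (EuclideanSpace.single j 1, 0) = ((∫ r in α..z.2, ψ r : ℝ) : ℂ) *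
        fderiv ℝ (fun w => a j w * u w) z (EuclideanSpace.single j 1, 0) := fun j => by
    simp only [mul_left_comm (a j _)]
    rw [fderiv_primitive_mul hψ α ((had j).fun_mul hud)]
    simp
  simp only [transpose, h]
  rw [fderiv_primitive_mul hψ α hud, ← Finset.mul_sum]
  push_cast
  ring

/-- The weak equation tested against `p(t) u(x, t)`, where `p(t) = ∫_α^t ψ`. Since `u` vanishes for
`t > β'`, this product has compact support although `p` itself need not vanish near `β`. -/
lemma integral_mul_eq_of_solvesWeakly (ha : ∀ j, ContDiffOn ℝ ∞ (a j) Ω)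
    (hf : LocallyIntegrableOn f (Ω : Set (Rn n × ℝ)))
    (hg : LocallyIntegrableOn g (Ω : Set (Rn n × ℝ))) (hfg : SolvesWeakly a Ω f g)
    {K : Set (Rn n)} (hK : IsCompact K) {α β' β : ℝ} (hαβ : α ≤ β) (hβ : β' < β)
    (hbox : K ×ˢ Icc α β ⊆ (Ω : Set (Rn n × ℝ))) {u : Rn n × ℝ → ℂ} (hu : ContDiffOn ℝ ∞ u Ω)
    (hu0 : ∀ z ∈ (Ω : Set (Rn n × ℝ)), z ∉ K ×ˢ Iic β' → u z = 0)
    {ψ : ℝ → ℝ} (hψ : ContDiff ℝ ∞ ψ) {α' : ℝ} (hα : α < α') (hψ0 : ∀ r ≤ α', ψ r = 0) :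
    ∫ t in α..β, (ψ t : ℂ) * ∫ x in K, f (x, t) * u (x, t) =
      ∫ t in α..β, (ψ t : ℂ) * ∫ s in t..β,
        ((∫ x in K, f (x, s) * transpose a u (x, s)) - ∫ x in K, g (x, s) * u (x, s)) := by
  -- The test function is `p(t) u(x, t)` on `Ω`, extended by `0`.
  set p : ℝ → ℝ := fun s => ∫ r in α..s, ψ r with hp
  have hp0 : ∀ s ≤ α', p s = 0 := fun s hs =>
    intervalIntegral.integral_zero_ae (Eventually.of_forall fun r hr => hψ0 r
      (hr.2.trans (max_le hα.le hs)))
  have hpc : ContDiff ℝ ∞ p := contDiff_primitive hψ α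
  have hpC : ContDiff ℝ ∞ fun z : Rn n × ℝ => (p z.2 : ℂ) :=
    Complex.ofRealCLM.contDiff.comp (hpc.comp contDiff_snd)
  set C : Set (Rn n × ℝ) := K ×ˢ Icc α' β' with hC
  have hCc : IsCompact C := hK.prod isCompact_Icc
  have hCΩ : C ⊆ Ω := (prod_mono_right (Icc_subset_Icc hα.le hβ.le)).trans hbox
  have hclosed : IsClosed (K ×ˢ Iic β') := hK.isClosed.prod isClosed_Iic
  have hTu : ContDiffOn ℝ ∞ (transpose a u) Ω :=
    (contDiffOn_transposeWithin Ω.isOpen.uniqueDiffOn ha hu).congr fun z hz =>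
      (transposeWithin_eq_transpose (Ω.isOpen.mem_nhds hz)).symm
  have hTu0 : ∀ z ∈ (Ω : Set (Rn n × ℝ)), z ∉ K ×ˢ Iic β' → transpose a u z = 0 := by
    intro z hz hzC
    rw [← transposeWithin_eq_transpose (Ω.isOpen.mem_nhds hz)]
    exact transposeWithin_eqOn_zero hclosed hu0 z hz hzC
  set Θ : Rn n × ℝ → ℂ := (Ω : Set (Rn n × ℝ)).indicator fun z => (p z.2 : ℂ) * u z with hΘ
  have hΘ0 : ∀ z ∉ C, Θ z = 0 := by
    intro z hz
    by_cases hzΩ : z ∈ (Ω : Set (Rn n × ℝ))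
    · rw [hΘ, indicator_of_mem hzΩ]
      by_cases hzK : z ∈ K ×ˢ Iic β'
      · rw [hp0 z.2 (not_lt.1 fun h => hz ⟨hzK.1, h.le, hzK.2⟩)]
        simp
      · rw [hu0 z hzΩ hzK, mul_zero]
    · exact indicator_of_notMem hzΩ _
  have hΘeq : ∀ z ∈ (Ω : Set (Rn n × ℝ)), Θ =ᶠ[𝓝 z] fun z => (p z.2 : ℂ) * u z := fun z hz => by
    filter_upwards [Ω.isOpen.mem_nhds hz] with w hw
    exact indicator_of_mem hw _
  have hΘc : ContDiff ℝ ∞ Θ := by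
    rw [contDiff_iff_contDiffAt]
    intro z
    by_cases hzΩ : z ∈ (Ω : Set (Rn n × ℝ))
    · exact (hpC.contDiffAt.mul (hu.contDiffAt (Ω.isOpen.mem_nhds hzΩ))).congr_of_eventuallyEq
        (hΘeq z hzΩ)
    · refine (contDiffAt_const (c := (0 : ℂ))).congr_of_eventuallyEq ?_
      filter_upwards [hCc.isClosed.isOpen_compl.mem_nhds fun h => hzΩ (hCΩ h)] with w hw
        using hΘ0 w hw
  have htsupp : tsupport Θ ⊆ C :=
    closure_minimal (fun z hz => by_contra fun h => hz (hΘ0 z h)) hCc.isClosed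
  have hweak := hfg ⟨Θ, hΘc, hCc.of_isClosed_subset (isClosed_tsupport _) htsupp,
    htsupp.trans hCΩ⟩
  change ∫ z in (Ω : Set (Rn n × ℝ)), f z * transpose a Θ z =
    ∫ z in (Ω : Set (Rn n × ℝ)), g z * Θ z at hweak
  have hsub : K ×ˢ Ioc α β ⊆ (Ω : Set (Rn n × ℝ)) :=
    (prod_mono_right Ioc_subset_Icc_self).trans hbox
  have hout : ∀ z ∈ (Ω : Set (Rn n × ℝ)) \ K ×ˢ Ioc α β, z ∈ K ×ˢ Iic β' → z.2 ≤ α := by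
    intro z hz hzK
    by_contra h
    exact hz.2 ⟨hzK.1, not_le.1 h, hzK.2.trans hβ.le⟩
  have hmeas : MeasurableSet (K ×ˢ Ioc α β) := hK.measurableSet.prod measurableSet_Ioc
  have hL : ∫ z in (Ω : Set (Rn n × ℝ)), f z * transpose a Θ z =
      ∫ z in K ×ˢ Ioc α β, ((p z.2 : ℂ) * (f z * transpose a u z) - ψ z.2 * (f z * u z)) := by
    rw [setIntegral_congr_fun Ω.isOpen.measurableSet (g := fun z =>
      (p z.2 : ℂ) * (f z * transpose a u z) - ψ z.2 * (f z * u z)) fun z hz => ?_]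
    · refine setIntegral_eq_of_subset_of_forall_sdiff_eq_zero Ω.isOpen.measurableSet hsub ?_
      intro z hz
      by_cases hzK : z ∈ K ×ˢ Iic β'
      · have h := (hout z hz hzK).trans hα.le
        simp [hp0 _ h, hψ0 _ h]
      · simp [hu0 z hz.1 hzK, hTu0 z hz.1 hzK]
    · simp only
      rw [transpose_congr (hΘeq z hz), transpose_primitive_mul ha hψ.continuous α hu hz]
      ring
  have hR : ∫ z in (Ω : Set (Rn n × ℝ)), g z * Θ z =
      ∫ z in K ×ˢ Ioc α β, (p z.2 : ℂ) * (g z * u z) := by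
    rw [setIntegral_congr_fun Ω.isOpen.measurableSet (g := fun z =>
      (p z.2 : ℂ) * (g z * u z)) fun z hz => ?_]
    · refine setIntegral_eq_of_subset_of_forall_sdiff_eq_zero Ω.isOpen.measurableSet hsub ?_
      intro z hz
      by_cases hzK : z ∈ K ×ˢ Iic β'
      · simp [hp0 _ ((hout z hz hzK).trans hα.le)]
      · simp [hu0 z hz.1 hzK]
    · simp only
      rw [(hΘeq z hz).eq_of_nhds]
      ring
  -- Both sides of the weak equation are integrated slice by slice.
  have hslice : ∀ {q : ℝ → ℝ} {F : Rn n × ℝ → ℂ} {v : Rn n × ℝ → ℂ}, Continuous q →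
      LocallyIntegrableOn F (Ω : Set (Rn n × ℝ)) → ContinuousOn v Ω →
      IntegrableOn (fun z => (q z.2 : ℂ) * (F z * v z)) (K ×ˢ Ioc α β) ∧
      ∫ z in K ×ˢ Ioc α β, (q z.2 : ℂ) * (F z * v z) =
        ∫ t in α..β, (q t : ℂ) * ∫ x in K, F (x, t) * v (x, t) := by
    intro q F v hq hF hv
    have hqv : ContinuousOn (fun z : Rn n × ℝ => (q z.2 : ℂ) * v z) Ω :=
      (Complex.continuous_ofReal.comp (hq.comp continuous_snd)).continuousOn.mul hv
    have hi := integrable_mul_box hF hK hbox hqv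
    have hi' : Integrable (fun z => (q z.2 : ℂ) * (F z * v z))
        ((volume.restrict K).prod (volume.restrict (Ioc α β))) := by
      refine hi.congr (Eventually.of_forall fun z => ?_)
      simp only
      ring
    refine ⟨?_, ?_⟩
    · rw [Measure.prod_restrict] at hi'
      exact hi'
    · rw [intervalIntegral.integral_of_le hαβ, Measure.volume_eq_prod, ← Measure.prod_restrict,
        integral_prod_symm _ hi']
      simp only [integral_const_mul]
  obtain ⟨i1, e1⟩ := hslice hpc.continuous hf hTu.continuousOn
  obtain ⟨i2, e2⟩ := hslice hψ.continuous hf hu.continuousOn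
  obtain ⟨i3, e3⟩ := hslice hpc.continuous hg hu.continuousOn
  rw [hL, hR, integral_sub i1 i2, e1, e2, e3] at hweak
  have hV1 := intervalIntegrable_integral_mul hαβ hf hK hbox hTu.continuousOn
  have hV2 := intervalIntegrable_integral_mul hαβ hg hK hbox hu.continuousOn
  have hpI : Continuous fun s => (p s : ℂ) := Complex.continuous_ofReal.comp hpc.continuous
  rw [integral_mul_integral_tail (w := fun t => (ψ t : ℂ)) hαβ
    ((Complex.continuous_ofReal.comp hψ.continuous).intervalIntegrable _ _) (hV1.sub hV2)]
  simp only [intervalIntegral.integral_ofReal]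
  simp only [mul_sub]
  rw [intervalIntegral.integral_sub (hV1.continuousOn_mul hpI.continuousOn)
    (hV2.continuousOn_mul hpI.continuousOn)]
  linear_combination -hweak

/-- The slice integral `H(t) = ∫_K f u dx` satisfies `H' = -∫_K (f ᵗLu - g u) dx` weakly and vanishes
near `β`; hence it is almost everywhere the integral of its derivative. -/
lemma ae_integral_eq_tail_of_solvesWeakly (ha : ∀ j, ContDiffOn ℝ ∞ (a j) Ω)
    (hf : LocallyIntegrableOn f (Ω : Set (Rn n × ℝ)))
    (hg : LocallyIntegrableOn g (Ω : Set (Rn n × ℝ))) (hfg : SolvesWeakly a Ω f g)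
    {K : Set (Rn n)} (hK : IsCompact K) {α β' β : ℝ} (hαβ : α ≤ β) (hβ : β' < β)
    (hbox : K ×ˢ Icc α β ⊆ (Ω : Set (Rn n × ℝ))) {u : Rn n × ℝ → ℂ} (hu : ContDiffOn ℝ ∞ u Ω)
    (hu0 : ∀ z ∈ (Ω : Set (Rn n × ℝ)), z ∉ K ×ˢ Iic β' → u z = 0) :
    ∀ᵐ t : ℝ, t ∈ Ioo α β → ∫ x in K, f (x, t) * u (x, t) =
      ∫ s in t..β,
        ((∫ x in K, f (x, s) * transpose a u (x, s)) - ∫ x in K, g (x, s) * u (x, s)) := by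
  have hTu : ContinuousOn (transpose a u) Ω :=
    ((contDiffOn_transposeWithin Ω.isOpen.uniqueDiffOn ha hu).congr fun z hz =>
      (transposeWithin_eq_transpose (Ω.isOpen.mem_nhds hz)).symm).continuousOn
  have hV := (intervalIntegrable_integral_mul hαβ hf hK hbox hTu).sub
    (intervalIntegrable_integral_mul hαβ hg hK hbox hu.continuousOn)
  have hH := intervalIntegrable_integral_mul hαβ hf hK hbox hu.continuousOn
  set V : ℝ → ℂ := fun s =>
    (∫ x in K, f (x, s) * transpose a u (x, s)) - ∫ x in K, g (x, s) * u (x, s) with hVdef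
  set H : ℝ → ℂ := fun t => ∫ x in K, f (x, t) * u (x, t) with hHdef
  have hR : ContinuousOn (fun t => ∫ s in t..β, V s) (uIcc α β) := by
    refine (intervalIntegral.continuousOn_primitive_interval_left
      (μ := volume) (f := V) ?_)
    rw [uIcc_of_le hαβ, integrableOn_Icc_iff_integrableOn_Ioc]
    exact (intervalIntegrable_iff_integrableOn_Ioc_of_le hαβ).1 hV
  have hRi : IntervalIntegrable (fun t => ∫ s in t..β, V s) volume α β := hR.intervalIntegrable
  have hD : IntegrableOn (fun t => H t - ∫ s in t..β, V s) (Ioo α β) :=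
    ((intervalIntegrable_iff_integrableOn_Ioc_of_le hαβ).1 (hH.sub hRi)).mono_set
      Ioo_subset_Ioc_self
  have h0 := isOpen_Ioo.ae_eq_zero_of_integral_contDiff_smul_eq_zero (U := Ioo α β)
    (μ := (volume : Measure ℝ)) hD.locallyIntegrableOn ?_
  · filter_upwards [h0] with t ht htI
    exact sub_eq_zero.1 (ht htI)
  intro ψ hψ hψc hψs
  have hψi : Continuous fun t => (ψ t : ℂ) := Complex.continuous_ofReal.comp hψ.continuous
  obtain ⟨α', hα, hψ0⟩ : ∃ α' > α, ∀ r ≤ α', ψ r = 0 := by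
    rcases (tsupport ψ).eq_empty_or_nonempty with he | hne
    · exact ⟨α + 1, by linarith, fun r _ => image_eq_zero_of_notMem_tsupport (by simp [he])⟩
    · obtain ⟨m, hm, hmin⟩ := IsCompact.exists_isLeast hψc hne
      refine ⟨(α + m) / 2, by linarith [(hψs hm).1], fun r hr => ?_⟩
      exact image_eq_zero_of_notMem_tsupport fun h => by linarith [hmin h, (hψs hm).1]
  have h1 := integral_mul_eq_of_solvesWeakly ha hf hg hfg hK hαβ hβ hbox hu hu0 hψ hα hψ0
  have h2 : ∫ t, ψ t • (H t - ∫ s in t..β, V s) =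
      ∫ t in α..β, (ψ t : ℂ) * (H t - ∫ s in t..β, V s) := by
    rw [intervalIntegral.integral_of_le hαβ]
    simp only [← Complex.real_smul]
    refine (setIntegral_eq_integral_of_forall_compl_eq_zero fun t ht => ?_).symm
    rw [image_eq_zero_of_notMem_tsupport fun h => ht (Ioo_subset_Ioc_self (hψs h)), zero_smul]
  rw [h2]
  simp only [mul_sub]
  rw [intervalIntegral.integral_sub (hH.continuousOn_mul hψi.continuousOn)
    (hRi.continuousOn_mul hψi.continuousOn), h1, sub_self]

end

/-! ### Integral representations of the slice pairings -/

section

variable {n : ℕ}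

/-- The pairing `⟨f(·, t), φ⟩ = ∫ f(x, t) φ(x) dx` of a slice with a test function; it is meaningful
for almost every `t` such that `supp φ` lies in the slice of the domain at height `t`. -/
noncomputable def slicePairing (f : Rn n × ℝ → ℂ) (φ : Rn n → ℝ) (t : ℝ) : ℂ :=
  ∫ x, f (x, t) * (φ x : ℂ)

lemma slicePairing_eq_setIntegral (f : Rn n × ℝ → ℂ) {φ : Rn n → ℝ} {K : Set (Rn n)}
    (hφ : tsupport φ ⊆ K) (t : ℝ) : slicePairing f φ t = ∫ x in K, f (x, t) * (φ x : ℂ) := by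
  refine (setIntegral_eq_integral_of_forall_compl_eq_zero fun x hx => ?_).symm
  rw [image_eq_zero_of_notMem_tsupport fun h => hx (hφ h)]
  simp

/-- A smooth function of time that is `1` for `t ≤ γ` and `0` for `t ≥ β`, when `γ < β`. -/
noncomputable def cutoff (γ β : ℝ) (t : ℝ) : ℝ := Real.smoothTransition ((β - t) / (β - γ))

lemma contDiff_cutoff (γ β : ℝ) : ContDiff ℝ ∞ (cutoff γ β) :=
  Real.smoothTransition.contDiff.comp ((contDiff_const.sub contDiff_id).div_const _)

lemma cutoff_eq_one {γ β t : ℝ} (h : γ < β) (ht : t ≤ γ) : cutoff γ β t = 1 :=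
  Real.smoothTransition.one_of_one_le (by rw [le_div_iff₀ (by linarith)]; linarith)

lemma cutoff_eq_zero {γ β t : ℝ} (h : γ < β) (ht : β ≤ t) : cutoff γ β t = 0 :=
  Real.smoothTransition.zero_of_nonpos (div_nonpos_of_nonpos_of_nonneg (by linarith) (by linarith))

lemma integrableOn_integral_mul {K : Set (Rn n)} {α β B : ℝ} {F u : Rn n × ℝ → ℂ}
    (hK : MeasurableSet K)
    (hF : IntegrableOn F (K ×ˢ Ioc α β)) {W : Set (Rn n × ℝ)} (hW : K ×ˢ Ioc α β ⊆ W)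
    (hu : ContinuousOn u W) (huB : ∀ z ∈ K ×ˢ Ioc α β, ‖u z‖ ≤ B) :
    IntegrableOn (fun s => ∫ x in K, F (x, s) * u (x, s)) (Ioc α β) ∧
    ∫ s in Ioc α β, ‖∫ x in K, F (x, s) * u (x, s)‖ ≤ B * ∫ z in K ×ˢ Ioc α β, ‖F z‖ := by
  have hmeas : MeasurableSet (K ×ˢ Ioc α β) := hK.prod measurableSet_Ioc
  have hFu : IntegrableOn (fun z => F z * u z) (K ×ˢ Ioc α β) :=
    Integrable.mul_bdd (c := B) hF ((hu.mono hW).aestronglyMeasurable hmeas)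
      (by filter_upwards [ae_restrict_mem hmeas] with z hz using huB z hz)
  have h2 := hFu
  rw [IntegrableOn, Measure.volume_eq_prod, ← Measure.prod_restrict] at h2
  refine ⟨h2.integral_prod_right, ?_⟩
  calc ∫ s in Ioc α β, ‖∫ x in K, F (x, s) * u (x, s)‖
      ≤ ∫ s in Ioc α β, ∫ x in K, ‖F (x, s) * u (x, s)‖ :=
        integral_mono h2.integral_prod_right.norm h2.norm.integral_prod_right
          fun s => norm_integral_le_integral_norm _
    _ = ∫ z in K ×ˢ Ioc α β, ‖F z * u z‖ := by
        rw [Measure.volume_eq_prod, ← Measure.prod_restrict, integral_prod_symm _ h2.norm]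
    _ ≤ ∫ z in K ×ˢ Ioc α β, B * ‖F z‖ := by
        refine setIntegral_mono_on hFu.norm (hF.norm.const_mul B) hmeas fun z hz => ?_
        rw [norm_mul, mul_comm]
        gcongr
        exact huB z hz
    _ = B * ∫ z in K ×ˢ Ioc α β, ‖F z‖ := integral_const_mul _ _

/-- The hypothesis is on the lower Lebesgue integral, so no integrability of `F` is assumed. -/
lemma norm_integral_mul_le_of_lintegral_le {K : Set (Rn n)} (hK : MeasurableSet K)
    {F u : Rn n → ℂ} {B D : ℝ}
    (hB : 0 ≤ B) (hD : 0 ≤ D) (hF : ∫⁻ x in K, ‖F x‖ₑ ≤ ENNReal.ofReal D)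
    (hu : ∀ x ∈ K, ‖u x‖ ≤ B) : ‖∫ x in K, F x * u x‖ ≤ B * D := by
  have h : ‖∫ x in K, F x * u x‖ₑ ≤ ENNReal.ofReal (B * D) := by
    calc ‖∫ x in K, F x * u x‖ₑ ≤ ∫⁻ x in K, ‖F x * u x‖ₑ := enorm_integral_le_lintegral_enorm _
      _ ≤ ∫⁻ x in K, ENNReal.ofReal B * ‖F x‖ₑ := by
        refine setLIntegral_mono' hK fun x hx => ?_
        rw [enorm_mul, mul_comm]
        gcongr
        rw [← ofReal_norm]
        exact ENNReal.ofReal_le_ofReal (hu x hx)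
      _ = ENNReal.ofReal B * ∫⁻ x in K, ‖F x‖ₑ := lintegral_const_mul' _ _ ENNReal.ofReal_ne_top
      _ ≤ ENNReal.ofReal B * ENNReal.ofReal D := by gcongr
      _ = ENNReal.ofReal (B * D) := (ENNReal.ofReal_mul hB).symm
  rw [← ofReal_norm] at h
  exact (ENNReal.ofReal_le_ofReal_iff (by positivity)).1 h

section Representation

variable {Ω : Opens (Rn n × ℝ)} {S : Set (Rn n × ℝ)} {a : Fin n → Rn n × ℝ → ℂ}
  {f g : Rn n × ℝ → ℂ}

/-- The iterates of the transpose turn the weak equation into the system of relations to which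
`integral_eq_taylor_expansion` applies. -/
lemma ae_slice_transpose_iterate (hΩS : (Ω : Set (Rn n × ℝ)) ⊆ S) (hS : UniqueDiffOn ℝ S)
    (ha : ∀ j, ContDiffOn ℝ ∞ (a j) S)
    (hf : LocallyIntegrableOn f (Ω : Set (Rn n × ℝ)))
    (hg : LocallyIntegrableOn g (Ω : Set (Rn n × ℝ))) (hfg : SolvesWeakly a Ω f g)
    {K : Set (Rn n)} (hK : IsCompact K) {α β' β : ℝ} (hαβ : α ≤ β) (hβ : β' < β)
    (hbox : K ×ˢ Icc α β ⊆ (Ω : Set (Rn n × ℝ))) {u : Rn n × ℝ → ℂ} (hu : ContDiffOn ℝ ∞ u S)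
    (hu0 : ∀ z ∈ S, z ∉ K ×ˢ Iic β' → u z = 0) (j : ℕ) :
    ∀ᵐ t : ℝ, t ∈ Ioo α β →
      ∫ x in K, f (x, t) * (transposeWithin S a)^[j] u (x, t) =
      ∫ s in t..β, ((∫ x in K, f (x, s) * (transposeWithin S a)^[j + 1] u (x, s)) -
        ∫ x in K, g (x, s) * (transposeWithin S a)^[j] u (x, s)) := by
  have hclosed : IsClosed (K ×ˢ Iic β') := hK.isClosed.prod isClosed_Iic
  have h := ae_integral_eq_tail_of_solvesWeakly (fun j => (ha j).mono hΩS) hf hg hfg hK hαβ hβ hbox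
    ((contDiffOn_iterate_transposeWithin hS ha hu j).mono hΩS)
    fun z hz hzC => iterate_transposeWithin_eqOn_zero hclosed hu0 j z (hΩS hz) hzC
  filter_upwards [h] with t ht htI
  rw [ht htI]
  refine intervalIntegral.integral_congr fun s hs => ?_
  rw [uIcc_of_le htI.2.le] at hs
  congr 1
  refine setIntegral_congr_fun hK.measurableSet fun x hx => ?_
  rw [Function.iterate_succ_apply', transposeWithin_eq_transpose]
  exact mem_of_superset
    (Ω.isOpen.mem_nhds (hbox ⟨hx, htI.1.le.trans hs.1, hs.2⟩)) hΩS

lemma continuousOn_tail_integral {V : ℝ → ℂ} {α β : ℝ} (hαβ : α ≤ β)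
    (hV : IntervalIntegrable V volume α β) : ContinuousOn (fun t => ∫ s in t..β, V s) (Icc α β) := by
  rw [← uIcc_of_le hαβ]
  refine intervalIntegral.continuousOn_primitive_interval_left (μ := volume) (f := V) ?_
  rw [uIcc_of_le hαβ, integrableOn_Icc_iff_integrableOn_Ioc]
  exact (intervalIntegrable_iff_integrableOn_Ioc_of_le hαβ).1 hV

lemma tensor_cutoff_eq_zero {K : Set (Rn n)} {φ : Rn n → ℝ} (hφ : tsupport φ ⊆ K) {γ β : ℝ}
    (h : γ < β) : ∀ z ∈ S, z ∉ K ×ˢ Iic β → tensor φ (cutoff γ β) z = 0 := by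
  intro z _ hz
  by_cases hz1 : z.1 ∈ K
  · have : β < z.2 := not_le.1 fun h' => hz ⟨hz1, h'⟩
    simp [tensor, cutoff_eq_zero h this.le]
  · simp [tensor, image_eq_zero_of_notMem_tsupport fun h' => hz1 (hφ h')]

lemma integral_mul_tensor_cutoff {K : Set (Rn n)} {φ : Rn n → ℝ} (hφ : tsupport φ ⊆ K) {γ β t : ℝ}
    (h : γ < β) (ht : t ≤ γ) :
    ∫ x in K, f (x, t) * tensor φ (cutoff γ β) (x, t) = slicePairing f φ t := by
  rw [slicePairing_eq_setIntegral f hφ]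
  simp [tensor, cutoff_eq_one h ht]

/-- Away from the boundary the slice pairings agree almost everywhere with a continuous function of
`t`, bounded by the `C¹` norm of the test function. -/
theorem exists_local_representation (ha : ∀ j, ContDiffOn ℝ ∞ (a j) Ω)
    (hf : LocallyIntegrableOn f (Ω : Set (Rn n × ℝ)))
    (hg : LocallyIntegrableOn g (Ω : Set (Rn n × ℝ))) (hfg : SolvesWeakly a Ω f g)
    {K : Set (Rn n)} (hK : IsCompact K) {α γ β : ℝ} (hαγ : α < γ) (hγβ : γ < β)
    (hbox : K ×ˢ Icc α β ⊆ (Ω : Set (Rn n × ℝ))) :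
    ∃ C, 0 ≤ C ∧ ∀ φ : Rn n → ℝ, ContDiff ℝ ∞ φ → HasCompactSupport φ → tsupport φ ⊆ K →
      ∃ R : ℝ → ℂ, ContinuousOn R (Ioo α γ) ∧
        (∀ᵐ t : ℝ, t ∈ Ioo α γ → slicePairing f φ t = R t) ∧
        ∀ t ∈ Ioo α γ, ‖R t‖ ≤ C * testNorm 1 φ := by
  have hS : UniqueDiffOn ℝ (Ω : Set (Rn n × ℝ)) := Ω.isOpen.uniqueDiffOn
  have hαβ : α ≤ β := (hαγ.trans hγβ).le
  have hγ1 : γ < (γ + β) / 2 := by linarith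
  have hβ1 : (γ + β) / 2 < β := by linarith
  have hc : IsCompact (K ×ˢ Icc α β) := hK.prod isCompact_Icc
  have hsub : K ×ˢ Ioc α β ⊆ K ×ˢ Icc α β := prod_mono_right Ioc_subset_Icc_self
  obtain ⟨C0, hC00, hC0⟩ := exists_norm_iterate_transposeWithin_tensor_le hS ha hc hbox
    (contDiff_cutoff γ ((γ + β) / 2)) 0
  obtain ⟨C1, hC10, hC1⟩ := exists_norm_iterate_transposeWithin_tensor_le hS ha hc hbox
    (contDiff_cutoff γ ((γ + β) / 2)) 1
  refine ⟨C1 * (∫ z in K ×ˢ Ioc α β, ‖f z‖) + C0 * ∫ z in K ×ˢ Ioc α β, ‖g z‖, ?_,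
    fun φ hφ hφc hφK => ?_⟩
  · have h1 : 0 ≤ ∫ z in K ×ˢ Ioc α β, ‖f z‖ := integral_nonneg fun _ => norm_nonneg _
    have h2 : 0 ≤ ∫ z in K ×ˢ Ioc α β, ‖g z‖ := integral_nonneg fun _ => norm_nonneg _
    positivity
  set u := tensor φ (cutoff γ ((γ + β) / 2)) with hu
  have huc : ContDiffOn ℝ ∞ u Ω := (contDiff_tensor hφ (contDiff_cutoff _ _)).contDiffOn
  have hrel := ae_slice_transpose_iterate subset_rfl hS ha hf hg hfg hK hαβ hβ1 hbox huc
    (tensor_cutoff_eq_zero hφK hγ1) 0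
  obtain ⟨i1, b1⟩ := integrableOn_integral_mul hK.measurableSet
    ((hf.integrableOn_compact_subset hbox hc).mono_set hsub) (hsub.trans hbox)
    (contDiffOn_iterate_transposeWithin hS ha huc 1).continuousOn
    fun z hz => hC1 φ hφ hφc z (hsub hz)
  obtain ⟨i0, b0⟩ := integrableOn_integral_mul hK.measurableSet
    ((hg.integrableOn_compact_subset hbox hc).mono_set hsub) (hsub.trans hbox)
    (contDiffOn_iterate_transposeWithin hS ha huc 0).continuousOn
    fun z hz => hC0 φ hφ hφc z (hsub hz)
  refine ⟨fun t => ∫ s in t..β,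
    ((∫ x in K, f (x, s) * (transposeWithin (Ω : Set (Rn n × ℝ)) a)^[1] u (x, s)) -
        ∫ x in K, g (x, s) * (transposeWithin (Ω : Set (Rn n × ℝ)) a)^[0] u (x, s)), ?_, ?_, ?_⟩
  · refine (continuousOn_tail_integral hαβ ?_).mono
      (Ioo_subset_Icc_self.trans (Icc_subset_Icc_right hγβ.le))
    rw [intervalIntegrable_iff_integrableOn_Ioc_of_le hαβ]
    exact i1.sub i0
  · filter_upwards [hrel] with t ht htI
    rw [← integral_mul_tensor_cutoff hφK hγ1 htI.2.le]
    exact ht ⟨htI.1, htI.2.trans hγβ⟩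
  · intro t ht
    have hsub' : Ioc t β ⊆ Ioc α β := Ioc_subset_Ioc_left ht.1.le
    simp only
    rw [intervalIntegral.integral_of_le (ht.2.trans hγβ).le]
    have i2 : IntegrableOn (fun s =>
        ‖∫ x in K, f (x, s) * (transposeWithin (Ω : Set (Rn n × ℝ)) a)^[1] u (x, s)‖ +
        ‖∫ x in K, g (x, s) * (transposeWithin (Ω : Set (Rn n × ℝ)) a)^[0] u (x, s)‖)
        (Ioc α β) := i1.norm.add i0.norm
    refine (norm_integral_le_of_norm_le (i2.mono_set hsub')
      (Eventually.of_forall fun s => norm_sub_le _ _)).trans ((setIntegral_mono_set i2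
        (Eventually.of_forall fun s => add_nonneg (norm_nonneg _) (norm_nonneg _))
        hsub'.eventuallyLE).trans ?_)
    rw [integral_add i1.norm i0.norm]
    have hg0 : 0 ≤ ∫ z in K ×ˢ Ioc α β, ‖g z‖ := integral_nonneg fun _ => norm_nonneg _
    calc _ ≤ C1 * testNorm 1 φ * (∫ z in K ×ˢ Ioc α β, ‖f z‖) +
          C0 * testNorm 0 φ * ∫ z in K ×ˢ Ioc α β, ‖g z‖ := add_le_add b1 b0
      _ ≤ C1 * testNorm 1 φ * (∫ z in K ×ˢ Ioc α β, ‖f z‖) +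
          C0 * testNorm 1 φ * ∫ z in K ×ˢ Ioc α β, ‖g z‖ := by
        gcongr
        exact testNorm_mono zero_le_one φ
      _ = _ := by ring

/-- Up to the boundary the continuous representative of the slice pairings is bounded by the
`C^{N+1}` norm of the test function and has a limit as `t → 0⁺`, where `N` is the order of growth of
`f`. Applying the transpose `N + 1` times produces the weight `(s - t)^N`, which compensates the
growth. -/
theorem exists_boundary_representation (hΩS : (Ω : Set (Rn n × ℝ)) ⊆ S) (hS : UniqueDiffOn ℝ S)
    (ha : ∀ j, ContDiffOn ℝ ∞ (a j) S)
    (hf : LocallyIntegrableOn f (Ω : Set (Rn n × ℝ)))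
    (hg : IntegrableOn g (Ω : Set (Rn n × ℝ))) (hfg : SolvesWeakly a Ω f g)
    {K : Set (Rn n)} (hK : IsCompact K) {δ : ℝ} (hδ : 0 < δ) (hδ1 : δ ≤ 1)
    (hbox : K ×ˢ Ioc 0 δ ⊆ (Ω : Set (Rn n × ℝ))) (hboxS : K ×ˢ Icc 0 δ ⊆ S)
    {N : ℕ} {C₀ : ℝ} (hgrowth : ∀ᵐ t : ℝ, t ∈ Ioo 0 δ →
      ∫⁻ x in K, ‖f (x, t)‖ₑ ≤ ENNReal.ofReal (C₀ / t ^ N)) :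
    ∃ C, 0 ≤ C ∧ ∀ φ : Rn n → ℝ, ContDiff ℝ ∞ φ → HasCompactSupport φ → tsupport φ ⊆ K →
      ∃ (R : ℝ → ℂ) (L : ℂ), ContinuousOn R (Ioo 0 (δ / 3)) ∧
        (∀ᵐ t : ℝ, t ∈ Ioo 0 (δ / 3) → slicePairing f φ t = R t) ∧
        (∀ t ∈ Ioo 0 (δ / 3), ‖R t‖ ≤ C * testNorm (N + 1) φ) ∧ Tendsto R (𝓝[>] 0) (𝓝 L) := by
  have hγ1 : δ / 3 < 2 * δ / 3 := by linarith
  have hβ1 : 2 * δ / 3 < δ := by linarith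
  have hc : IsCompact (K ×ˢ Icc 0 δ) := hK.prod isCompact_Icc
  have hsub : K ×ˢ Ioc 0 δ ⊆ K ×ˢ Icc 0 δ := prod_mono_right Ioc_subset_Icc_self
  have hmeas : MeasurableSet (K ×ˢ Ioc 0 δ) := hK.measurableSet.prod measurableSet_Ioc
  have hg' : LocallyIntegrableOn g (Ω : Set (Rn n × ℝ)) := hg.locallyIntegrableOn
  choose C hC0 hC using fun j => exists_norm_iterate_transposeWithin_tensor_le hS ha hc hboxS
    (contDiff_cutoff (δ / 3) (2 * δ / 3)) j
  set G : ℝ := ∫ z in K ×ˢ Ioc 0 δ, ‖g z‖ with hG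
  have hG0 : 0 ≤ G := integral_nonneg fun _ => norm_nonneg _
  refine ⟨C (N + 1) * |C₀| + ∑ j ∈ Finset.range (N + 1), C j * G,
    add_nonneg (mul_nonneg (hC0 _) (abs_nonneg _))
      (Finset.sum_nonneg fun j _ => mul_nonneg (hC0 j) hG0), fun φ hφ hφc hφK => ?_⟩
  set u := tensor φ (cutoff (δ / 3) (2 * δ / 3)) with hu
  have huc : ContDiffOn ℝ ∞ u S := (contDiff_tensor hφ (contDiff_cutoff _ _)).contDiffOn
  have hTc : ∀ j, ContinuousOn ((transposeWithin S a)^[j] u) S := fun j =>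
    (contDiffOn_iterate_transposeWithin hS ha huc j).continuousOn
  set H : ℕ → ℝ → ℂ := fun j t => ∫ x in K, f (x, t) * (transposeWithin S a)^[j] u (x, t) with hH
  set k : ℕ → ℝ → ℂ := fun j t => ∫ x in K, g (x, t) * (transposeWithin S a)^[j] u (x, t) with hk
  have hboxα : ∀ {α : ℝ}, 0 < α → K ×ˢ Icc α δ ⊆ (Ω : Set (Rn n × ℝ)) := fun hα =>
    fun z hz => hbox ⟨hz.1, hα.trans_le hz.2.1, hz.2.2⟩
  have hrel : ∀ {α : ℝ}, 0 < α → α ≤ δ → ∀ j, ∀ᵐ t : ℝ, t ∈ Ioo α δ →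
      H j t = ∫ s in t..δ, (H (j + 1) s - k j s) := fun hα hαδ j =>
    ae_slice_transpose_iterate hΩS hS ha hf hg' hfg hK hαδ hβ1 (hboxα hα) huc
      (tensor_cutoff_eq_zero hφK hγ1) j
  have hHi : ∀ {α : ℝ}, 0 < α → α ≤ δ → ∀ j, IntervalIntegrable (H j) volume α δ :=
    fun hα hαδ j => intervalIntegrable_integral_mul hαδ hf hK (hboxα hα) ((hTc j).mono hΩS)
  have hkb : ∀ j, IntegrableOn (k j) (Ioc 0 δ) ∧
      ∫ s in Ioc 0 δ, ‖k j s‖ ≤ C j * testNorm j φ * G := fun j =>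
    integrableOn_integral_mul hK.measurableSet (hg.mono_set hbox) (hsub.trans hboxS) (hTc j)
      fun z hz => hC j φ hφ hφc z (hsub hz)
  have hki : ∀ {α : ℝ}, 0 < α → α ≤ δ → ∀ j, IntervalIntegrable (k j) volume α δ :=
    fun hα hαδ j => by
      rw [intervalIntegrable_iff_integrableOn_Ioc_of_le hαδ]
      exact (hkb j).1.mono_set (Ioc_subset_Ioc_left hα.le)
  have hHm : AEStronglyMeasurable (H (N + 1)) (volume.restrict (Ioc 0 δ)) := by
    have h1 : AEStronglyMeasurable (fun z => f z * (transposeWithin S a)^[N + 1] u z)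
        (volume.restrict (K ×ˢ Ioc 0 δ)) :=
      (hf.aestronglyMeasurable.mono_measure (Measure.restrict_mono hbox le_rfl)).mul
        (((hTc (N + 1)).mono (hsub.trans hboxS)).aestronglyMeasurable hmeas)
    rw [Measure.volume_eq_prod, ← Measure.prod_restrict] at h1
    exact h1.prod_swap.integral_prod_right'
  -- The growth condition is exactly compensated by the weight `s ^ N`.
  have hHb : ∀ᵐ s ∂(volume.restrict (Ioc 0 δ)),
      s ^ N * ‖H (N + 1) s‖ ≤ C (N + 1) * testNorm (N + 1) φ * |C₀| := by
    have hne : ∀ᵐ s : ℝ, s ≠ δ := by simp [ae_iff]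
    filter_upwards [ae_restrict_mem measurableSet_Ioc, ae_restrict_of_ae hgrowth,
      ae_restrict_of_ae hne] with s hs hgs hsδ
    have hs0 : 0 < s := hs.1
    have h1 : ‖H (N + 1) s‖ ≤ C (N + 1) * testNorm (N + 1) φ * (|C₀| / s ^ N) := by
      refine norm_integral_mul_le_of_lintegral_le (F := fun x => f (x, s))
        (u := fun x => (transposeWithin S a)^[N + 1] u (x, s)) hK.measurableSet
        (mul_nonneg (hC0 _) (testNorm_nonneg _ _)) (by positivity)
        ((hgs ⟨hs0, lt_of_le_of_ne hs.2 hsδ⟩).trans (ENNReal.ofReal_le_ofReal ?_))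
        fun x hx => hC _ φ hφ hφc _ ⟨hx, hs0.le, hs.2⟩
      gcongr
      exact le_abs_self _
    calc s ^ N * ‖H (N + 1) s‖
        ≤ s ^ N * (C (N + 1) * testNorm (N + 1) φ * (|C₀| / s ^ N)) := by gcongr
      _ = C (N + 1) * testNorm (N + 1) φ * |C₀| := by field_simp
  have hHw : IntegrableOn (fun s => s ^ N * ‖H (N + 1) s‖) (Ioc 0 δ) := by
    refine IntegrableOn.of_bound measure_Ioc_lt_top
      ((continuous_pow N).aestronglyMeasurable.mul hHm.norm)
      (C (N + 1) * testNorm (N + 1) φ * |C₀|) ?_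
    filter_upwards [ae_restrict_mem measurableSet_Ioc, hHb] with s hs h
    have := hs.1.le
    rw [Real.norm_of_nonneg (by positivity)]
    exact h
  have hpow : ∀ j : ℕ, ∀ s ∈ Ioc 0 δ, s ^ j ≤ 1 := fun j s hs =>
    pow_le_one₀ hs.1.le (hs.2.trans hδ1)
  have hkw : ∀ j, IntegrableOn (fun s => s ^ j * ‖k j s‖) (Ioc 0 δ) := fun j => by
    refine Integrable.mono' (hkb j).1.norm
      ((continuous_pow j).aestronglyMeasurable.mul (hkb j).1.aestronglyMeasurable.norm) ?_
    filter_upwards [ae_restrict_mem measurableSet_Ioc] with s hs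
    have := hs.1.le
    rw [Real.norm_of_nonneg (by positivity)]
    exact mul_le_of_le_one_left (norm_nonneg _) (hpow j s hs)
  have htaylor : ∀ t ∈ Ioo 0 δ, ∫ s in t..δ, (H 1 s - k 0 s) =
      (∫ s in t..δ, (taylorWeight N t s : ℂ) * H (N + 1) s) -
        ∑ j ∈ Finset.range (N + 1), ∫ s in t..δ, (taylorWeight j t s : ℂ) * k j s := fun t ht =>
    integral_eq_taylor_expansion (α := t) (hHi ht.1 ht.2.le) (hki ht.1 ht.2.le)
      (hrel ht.1 ht.2.le) N ⟨le_rfl, ht.2.le⟩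
  refine ⟨fun t => ∫ s in t..δ, (H 1 s - k 0 s),
    (∫ s in Ioc 0 δ, (taylorWeight N 0 s : ℂ) * H (N + 1) s) -
        ∑ j ∈ Finset.range (N + 1), ∫ s in Ioc 0 δ, (taylorWeight j 0 s : ℂ) * k j s,
    ?_, ?_, ?_, ?_⟩
  · intro t ht
    have h2 : 0 < t / 2 := half_pos ht.1
    have h3 : t / 2 ≤ δ := by linarith [ht.2]
    refine ((continuousOn_tail_integral h3 ((hHi h2 h3 1).sub (hki h2 h3 0))).continuousAt
      (Icc_mem_nhds (half_lt_self ht.1) (by linarith [ht.2]))).continuousWithinAt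
  · have h : ∀ i : ℕ, ∀ᵐ t : ℝ, t ∈ Ioo (δ / (i + 1)) δ →
        H 0 t = ∫ s in t..δ, (H 1 s - k 0 s) := fun i =>
      hrel (by positivity) (div_le_self hδ.le (by linarith [(Nat.cast_nonneg i : (0 : ℝ) ≤ i)])) 0
    filter_upwards [ae_all_iff.2 h] with t ht htI
    obtain ⟨i, hi⟩ := exists_nat_gt (δ / t)
    have hi' : δ / (i + 1) < t := by
      rw [div_lt_iff₀ htI.1] at hi
      rw [div_lt_iff₀ (by positivity)]
      nlinarith [htI.1]
    rw [← integral_mul_tensor_cutoff hφK hγ1 htI.2.le]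
    exact ht i ⟨hi', by linarith [htI.2]⟩
  · intro t ht
    have htδ : t ∈ Ioc 0 δ := ⟨ht.1, by linarith [ht.2]⟩
    simp only
    rw [htaylor t ⟨ht.1, by linarith [ht.2]⟩, add_mul]
    refine (norm_sub_le _ _).trans (add_le_add ?_ ((norm_sum_le _ _).trans ?_))
    · refine (norm_integral_taylorWeight_mul_le hHw htδ).trans ?_
      calc ∫ s in Ioc 0 δ, s ^ N * ‖H (N + 1) s‖
          ≤ ∫ s in Ioc 0 δ, C (N + 1) * testNorm (N + 1) φ * |C₀| :=
            integral_mono_ae hHw (integrable_const _) hHb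
        _ = δ * (C (N + 1) * testNorm (N + 1) φ * |C₀|) := by
            simp [hδ.le]
        _ ≤ 1 * (C (N + 1) * testNorm (N + 1) φ * |C₀|) := by
            have := hC0 (N + 1)
            have := testNorm_nonneg (N + 1) φ
            gcongr
        _ = C (N + 1) * |C₀| * testNorm (N + 1) φ := by ring
    · rw [Finset.sum_mul]
      refine Finset.sum_le_sum fun j hj => ?_
      refine (norm_integral_taylorWeight_mul_le (hkw j) htδ).trans ?_
      calc ∫ s in Ioc 0 δ, s ^ j * ‖k j s‖ ≤ ∫ s in Ioc 0 δ, ‖k j s‖ :=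
            setIntegral_mono_on (hkw j) (hkb j).1.norm measurableSet_Ioc fun s hs =>
              mul_le_of_le_one_left (norm_nonneg _) (hpow j s hs)
        _ ≤ C j * testNorm j φ * G := (hkb j).2
        _ ≤ C j * testNorm (N + 1) φ * G := by
            have := hC0 j
            gcongr
            exact testNorm_mono (Finset.mem_range.1 hj).le φ
        _ = C j * G * testNorm (N + 1) φ := by ring
  · refine ((tendsto_integral_taylorWeight_mul hδ hHm hHw).sub (tendsto_finsetSum _ fun j _ =>
      tendsto_integral_taylorWeight_mul hδ (hkb j).1.aestronglyMeasurable (hkw j))).congr' ?_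
    filter_upwards [Ioo_mem_nhdsGT hδ] with t ht using (htaylor t ht).symm

end Representation

end

/-! ### Test functions supported in a compact set -/

section

variable {n : ℕ}

/-- The function `φ` is smooth with compact support contained in `K`. Unlike the elements of
`𝓓(V, ℝ)`, such functions are not tied to an open set, which varies with `t` for the traces. -/
structure IsTestOn (K : Set (Rn n)) (φ : Rn n → ℝ) : Prop where
  contDiff : ContDiff ℝ ∞ φ
  hasCompactSupport : HasCompactSupport φ
  tsupport_subset : tsupport φ ⊆ K

lemma IsTestOn.mono {K K' : Set (Rn n)} {φ : Rn n → ℝ} (h : IsTestOn K φ) (hK : K ⊆ K') :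
    IsTestOn K' φ :=
  ⟨h.1, h.2, h.3.trans hK⟩

lemma IsTestOn.add_smul {K : Set (Rn n)} {φ ψ : Rn n → ℝ} (hφ : IsTestOn K φ) (hψ : IsTestOn K ψ)
    (c : ℝ) : IsTestOn K (φ + c • ψ) :=
  ⟨hφ.1.add (hψ.1.const_smul c), hφ.2.add hψ.2.smul_left,
    (tsupport_add _ _).trans (union_subset hφ.3
      ((closure_mono (Function.support_const_smul_subset c ψ)).trans hψ.3))⟩

lemma isTestOn_tsupport {V : Opens (Rn n)} (φ : 𝓓(V, ℝ)) : IsTestOn (tsupport φ) φ :=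
  ⟨φ.contDiff, φ.hasCompactSupport, subset_rfl⟩

/-- A linear functional with a seminorm estimate on each compact set is a distribution. -/
lemma exists_distribution {V : Opens (Rn n)} (T : 𝓓(V, ℝ) → ℂ)
    (hadd : ∀ φ ψ, T (φ + ψ) = T φ + T ψ) (hsmul : ∀ (c : ℝ) φ, T (c • φ) = c • T φ)
    (hb : ∀ K : Set (Rn n), IsCompact K → K ⊆ V → ∃ (m : ℕ) (C : ℝ), 0 ≤ C ∧ ∀ φ : 𝓓(V, ℝ),
      tsupport φ ⊆ K → ‖T φ‖ ≤ C * testNorm m φ) :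
    ∃ S : 𝓓'(V, ℂ), ∀ φ, S φ = T φ := by
  refine ⟨(TestFunction.mkCLM ℝ T hadd hsmul fun K hK => ?_ : 𝓓(V, ℝ) →L[ℝ] ℂ), fun φ => rfl⟩
  obtain ⟨m, C, hC, hT⟩ := hb K K.isCompact hK
  refine (ContDiffMapSupportedIn.mkCLMtoNormedSpace ℝ (T ∘ TestFunction.ofSupportedIn hK)
    (fun φ ψ => hadd (.ofSupportedIn hK φ) (.ofSupportedIn hK ψ))
    (fun c φ => hsmul c (.ofSupportedIn hK φ)) ⟨Finset.range (m + 1), C * (m + 1), by positivity,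
      fun φ => ?_⟩ : 𝓓_{K}(Rn n, ℝ) →L[ℝ] ℂ).continuous
  refine (hT _ φ.tsupport_subset).trans ?_
  rw [mul_assoc]
  refine mul_le_mul_of_nonneg_left ?_ hC
  have h : ∀ i ∈ Finset.range (m + 1), ⨆ x, ‖iteratedFDeriv ℝ i φ x‖ ≤
      ((Finset.range (m + 1)).sup fun i => ContDiffMapSupportedIn.seminorm ℝ (Rn n) ℝ ⊤ K i) φ :=
    fun i hi => ciSup_le fun x =>
      (ContDiffMapSupportedIn.norm_iteratedFDeriv_apply_le_seminorm_top ℝ).trans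
        (Seminorm.le_finset_sup_apply
          (p := fun i => ContDiffMapSupportedIn.seminorm ℝ (Rn n) ℝ ⊤ K i) hi)
  refine (Finset.sum_le_sum h).trans ?_
  simp

/-- The test functions supported in a compact set are separable in the `C¹` norm, because
`φ ↦ (φ, Dφ)` embeds them in a separable space of continuous functions on `K`. -/
lemma exists_countable_dense_isTestOn {K : Set (Rn n)} (hK : IsCompact K) :
    ∃ D : Set (Rn n → ℝ), D.Countable ∧ (∀ d ∈ D, IsTestOn K d) ∧
      ∀ φ, IsTestOn K φ → ∀ ε > 0, ∃ d ∈ D, testNorm 1 (φ + (-1 : ℝ) • d) ≤ ε := by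
  have : CompactSpace K := isCompact_iff_compactSpace.1 hK
  let ι : {φ : Rn n → ℝ // IsTestOn K φ} → C(K, ℝ) × C(K, Rn n →L[ℝ] ℝ) := fun φ =>
    (⟨fun x => φ.1 x, φ.2.contDiff.continuous.comp continuous_subtype_val⟩,
      ⟨fun x => fderiv ℝ φ.1 x,
        (φ.2.contDiff.continuous_fderiv (by simp)).comp continuous_subtype_val⟩)
  obtain ⟨t, htr, htc, htd⟩ :=
    (IsSeparable.of_separableSpace (range ι)).exists_countable_dense_subset
  choose s hs using fun y : t => htr y.2
  have : Countable t := htc.to_subtype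
  refine ⟨range fun y => (s y).1, countable_range _, ?_, fun φ hφ ε hε => ?_⟩
  · rintro _ ⟨y, rfl⟩
    exact (s y).2
  obtain ⟨y, hyt, hy⟩ := 
    (Metric.mem_closure_iff (s := t) (a := ι ⟨φ, hφ⟩)).1 (htd ⟨⟨φ, hφ⟩, rfl⟩) (ε / 2) (half_pos hε)
  refine ⟨_, ⟨⟨y, hyt⟩, rfl⟩, ?_⟩
  set d := s ⟨y, hyt⟩ with hd
  have hyd : ι d = y := hs ⟨y, hyt⟩
  rw [← hyd, Prod.dist_eq, max_lt_iff] at hy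
  have hsub := hφ.add_smul d.2 (-1)
  have h0 : ∀ x, ‖(φ + (-1 : ℝ) • d.1) x‖ ≤ ε / 2 := fun x => by
    by_cases hx : x ∈ K
    · have h := (ContinuousMap.dist_apply_le_dist (f := (ι ⟨φ, hφ⟩).1) (g := (ι d).1)
        ⟨x, hx⟩).trans hy.1.le
      rw [dist_eq_norm] at h
      simpa [ι, sub_eq_add_neg] using h
    · rw [image_eq_zero_of_notMem_tsupport fun h => hx (hsub.3 h), norm_zero]
      exact (half_pos hε).le
  have h1 : ∀ x, ‖fderiv ℝ (φ + (-1 : ℝ) • d.1) x‖ ≤ ε / 2 := fun x => by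
    by_cases hx : x ∈ K
    · have h := (ContinuousMap.dist_apply_le_dist (f := (ι ⟨φ, hφ⟩).2) (g := (ι d).2)
        ⟨x, hx⟩).trans hy.2.le
      rw [dist_eq_norm] at h
      have e : fderiv ℝ (φ + (-1 : ℝ) • d.1) x = fderiv ℝ φ x - fderiv ℝ d.1 x := by
        have hdφ := (hφ.contDiff.differentiable (by simp)) x
        have hdd := (d.2.contDiff.differentiable (by simp)) x
        rw [fderiv_add hdφ (hdd.const_smul _), fderiv_const_smul hdd]
        simp [sub_eq_add_neg]
      rw [e]
      exact h
    · have h : x ∉ tsupport (fderiv ℝ (φ + (-1 : ℝ) • d.1)) := fun h =>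
        hx (hsub.3 (tsupport_fderiv_subset ℝ h))
      rw [image_eq_zero_of_notMem_tsupport h, norm_zero]
      exact (half_pos hε).le
  calc testNorm 1 (φ + (-1 : ℝ) • d.1)
      = (⨆ x, ‖iteratedFDeriv ℝ 0 (φ + (-1 : ℝ) • d.1) x‖) +
        ⨆ x, ‖iteratedFDeriv ℝ 1 (φ + (-1 : ℝ) • d.1) x‖ := by
        simp only [testNorm, Finset.sum_range_succ, Finset.sum_range_zero, zero_add]
    _ ≤ ε / 2 + ε / 2 := by
        refine add_le_add (ciSup_le fun x => ?_) (ciSup_le fun x => ?_)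
        · rw [norm_iteratedFDeriv_zero]; exact h0 x
        · rw [norm_iteratedFDeriv_one]; exact h1 x
    _ = ε := by ring

/-! ### Boxes in an open set -/

lemma exists_box_subset {Ω : Opens (Rn n × ℝ)} {K : Set (Rn n)} (hK : IsCompact K) {t : ℝ}
    (hKt : ∀ x ∈ K, (x, t) ∈ Ω) :
    ∃ ε > 0, K ×ˢ Icc (t - ε) (t + ε) ⊆ (Ω : Set (Rn n × ℝ)) := by
  obtain ⟨u, v, -, hv, hKu, htv, huv⟩ := generalized_tube_lemma hK (isCompact_singleton (x := t))
    Ω.isOpen (by rintro ⟨x, s⟩ ⟨hx, rfl⟩; exact hKt x hx)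
  obtain ⟨ε, hε, hball⟩ := Metric.isOpen_iff.1 hv t (htv rfl)
  refine ⟨ε / 2, half_pos hε, (prod_mono hKu ?_).trans huv⟩
  rw [← Real.closedBall_eq_Icc]
  exact (Metric.closedBall_subset_ball (half_lt_self hε)).trans hball

/-- Countably many compact boxes `B × [q₁, q₂]` in `Ω` such that each compact subset of each slice
lies in the interior, with respect to `t`, of one of them. -/
lemma exists_countable_boxes (Ω : Opens (Rn n × ℝ)) :
    ∃ B : ℕ × ℚ × ℚ → Set (Rn n), (∀ i, IsCompact (B i)) ∧
      (∀ i, B i ×ˢ Icc (i.2.1 : ℝ) i.2.2 ⊆ (Ω : Set (Rn n × ℝ))) ∧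
      ∀ (K : Set (Rn n)) (t : ℝ), IsCompact K → K ⊆ slice Ω t →
        ∃ i : ℕ × ℚ × ℚ, K ⊆ B i ∧ t ∈ Ioo (i.2.1 : ℝ) i.2.2 := by
  have : LocallyCompactSpace Ω := Ω.isOpen.locallyCompactSpace
  let E := CompactExhaustion.choice Ω
  have hE : ∀ m, IsCompact (Subtype.val '' E m : Set (Rn n × ℝ)) := fun m =>
    (E.isCompact m).image continuous_subtype_val
  refine ⟨fun i => (Prod.fst '' (Subtype.val '' E i.1 : Set (Rn n × ℝ))) ∩
    ⋂ s ∈ Icc (i.2.1 : ℝ) i.2.2, {x | (x, s) ∈ (Subtype.val '' E i.1 : Set (Rn n × ℝ))},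
    fun i => ?_, fun i => ?_, fun K t hK hKt => ?_⟩
  · refine ((hE i.1).image continuous_fst).inter_right (isClosed_biInter fun s _ => ?_)
    exact (hE i.1).isClosed.preimage (by fun_prop : Continuous fun x : Rn n => (x, s))
  · rintro ⟨x, s⟩ ⟨⟨-, hx⟩, hs⟩
    obtain ⟨z, -, hz⟩ := mem_iInter₂.1 hx s hs
    rw [← hz]
    exact z.2
  · obtain ⟨ε, hε, hbox⟩ := exists_box_subset hK (t := t) (Ω := Ω) hKt
    obtain ⟨q₁, hq₁, hq₁'⟩ := exists_rat_btwn (show t - ε < t by linarith)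
    obtain ⟨q₂, hq₂, hq₂'⟩ := exists_rat_btwn (show t < t + ε by linarith)
    have hQ : IsCompact (Subtype.val ⁻¹' (K ×ˢ Icc (t - ε) (t + ε)) : Set Ω) := by
      rw [Subtype.isCompact_iff, image_preimage_eq_of_subset (by rwa [Subtype.range_coe])]
      exact hK.prod isCompact_Icc
    obtain ⟨m, hm⟩ := E.exists_superset_of_isCompact hQ
    have key : ∀ x ∈ K, ∀ s ∈ Icc (q₁ : ℝ) q₂, (x, s) ∈ (Subtype.val '' E m : Set (Rn n × ℝ)) := by
      intro x hx s hs
      have hmem : (x, s) ∈ K ×ˢ Icc (t - ε) (t + ε) :=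
        ⟨hx, hq₁.le.trans hs.1, hs.2.trans hq₂'.le⟩
      exact ⟨⟨(x, s), hbox hmem⟩, hm hmem, rfl⟩
    refine ⟨(m, q₁, q₂), fun x hx => ⟨⟨(x, t), key x hx t ⟨hq₁'.le, hq₂.le⟩, rfl⟩, ?_⟩,
      hq₁', hq₂⟩
    exact mem_iInter₂.2 fun s hs => key x hx s hs

/-! ### Values of the traces -/

/-- A property that holds for almost every `s` near `t` holds for some `s` in each neighbourhood
of `t`. -/
instance neBot_ae_inf_nhds (t : ℝ) : (ae (volume : Measure ℝ) ⊓ 𝓝 t).NeBot := by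
  rw [Filter.inf_neBot_iff]
  intro s hs s' hs'
  by_contra h
  have hsub : s' ⊆ sᶜ := fun x hx hxs => h ⟨x, hxs, hx⟩
  exact (MeasureTheory.Measure.measure_pos_of_mem_nhds volume hs').ne' (measure_mono_null hsub hs)

/-- The value `⟨f(·, t), φ⟩` of the trace: the limit at `t` of the slice pairings outside of null
sets. Like every `limUnder` it is a junk value unless the limit exists, see `HasTraceAt`. -/
noncomputable def traceValue (f : Rn n × ℝ → ℂ) (φ : Rn n → ℝ) (t : ℝ) : ℂ :=
  limUnder (ae volume ⊓ 𝓝 t) (slicePairing f φ)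

/-- The slice pairings of `f` with `φ` have the limit `L` at `t`, when null sets of times are
disregarded. -/
def HasTraceAt (f : Rn n × ℝ → ℂ) (φ : Rn n → ℝ) (t : ℝ) (L : ℂ) : Prop :=
  Tendsto (slicePairing f φ) (ae volume ⊓ 𝓝 t) (𝓝 L)

lemma HasTraceAt.traceValue_eq {f : Rn n × ℝ → ℂ} {φ : Rn n → ℝ} {t : ℝ} {L : ℂ}
    (h : HasTraceAt f φ t L) : traceValue f φ t = L :=
  h.limUnder_eq

lemma hasTraceAt_of_ae_eq {f : Rn n × ℝ → ℂ} {φ : Rn n → ℝ} {α β : ℝ} {R : ℝ → ℂ}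
    (hae : ∀ᵐ t : ℝ, t ∈ Ioo α β → slicePairing f φ t = R t) {t : ℝ}
    (ht : t ∈ Ioo α β) (hR : ContinuousAt R t) : HasTraceAt f φ t (R t) := by
  refine (hR.tendsto.mono_left inf_le_right).congr' ?_
  filter_upwards [mem_inf_of_left hae, mem_inf_of_right (isOpen_Ioo.mem_nhds ht)] with s hs hsI
    using (hs hsI).symm

section Linear

variable {Ω : Opens (Rn n × ℝ)} {f : Rn n × ℝ → ℂ} {K : Set (Rn n)} {α β : ℝ}

lemma ae_integrableOn_slice (hf : LocallyIntegrableOn f (Ω : Set (Rn n × ℝ))) (hK : IsCompact K)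
    (hbox : K ×ˢ Icc α β ⊆ (Ω : Set (Rn n × ℝ))) :
    ∀ᵐ t : ℝ, t ∈ Ioo α β → IntegrableOn (fun x => f (x, t)) K := by
  have h := hf.integrableOn_compact_subset hbox (hK.prod isCompact_Icc)
  rw [IntegrableOn, Measure.volume_eq_prod, ← Measure.prod_restrict] at h
  filter_upwards [(ae_restrict_iff' measurableSet_Icc).1 h.prod_left_ae] with t ht htI
    using ht (Ioo_subset_Icc_self htI)

lemma integrableOn_mul_test {F : Rn n → ℂ} (hF : IntegrableOn F K) {φ : Rn n → ℝ}
    (hφ : IsTestOn K φ) : IntegrableOn (fun x => F x * (φ x : ℂ)) K := by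
  obtain ⟨C, hC⟩ := hφ.contDiff.continuous.bounded_above_of_compact_support hφ.hasCompactSupport
  exact Integrable.mul_bdd (c := C) hF
    (Complex.continuous_ofReal.comp hφ.contDiff.continuous).aestronglyMeasurable
    (Eventually.of_forall fun x => by rw [Complex.norm_real]; exact hC x)

lemma slicePairing_add_smul {t : ℝ} (hF : IntegrableOn (fun x => f (x, t)) K) {φ ψ : Rn n → ℝ}
    (hφ : IsTestOn K φ) (hψ : IsTestOn K ψ) (c : ℝ) :
    slicePairing f (φ + c • ψ) t = slicePairing f φ t + c * slicePairing f ψ t := by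
  rw [slicePairing_eq_setIntegral f (hφ.add_smul hψ c).3, slicePairing_eq_setIntegral f hφ.3,
    slicePairing_eq_setIntegral f hψ.3, ← integral_const_mul,
    ← integral_add (integrableOn_mul_test hF hφ) ((integrableOn_mul_test hF hψ).const_mul _)]
  congr 1
  ext x
  simp only [Pi.add_apply, Pi.smul_apply, smul_eq_mul]
  push_cast
  ring

lemma HasTraceAt.add_smul (hf : LocallyIntegrableOn f (Ω : Set (Rn n × ℝ))) (hK : IsCompact K)
    {t : ℝ} (hKt : ∀ x ∈ K, (x, t) ∈ Ω) {φ ψ : Rn n → ℝ}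
    (hφ : IsTestOn K φ) (hψ : IsTestOn K ψ) {L M : ℂ} (hL : HasTraceAt f φ t L)
    (hM : HasTraceAt f ψ t M) (c : ℝ) : HasTraceAt f (φ + c • ψ) t (L + c * M) := by
  obtain ⟨ε, hε, hbox⟩ := exists_box_subset hK hKt
  refine (Tendsto.add hL (Tendsto.const_mul (c : ℂ) hM)).congr' ?_
  filter_upwards [mem_inf_of_left (ae_integrableOn_slice hf hK hbox),
    mem_inf_of_right (Ioo_mem_nhds (show t - ε < t by linarith) (show t < t + ε by linarith))]
    with s hs hsI
  exact (slicePairing_add_smul (hs hsI) hφ hψ c).symm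

end Linear

section Traces

variable {Ω : Opens (Rn n × ℝ)} {a : Fin n → Rn n × ℝ → ℂ} {f g : Rn n × ℝ → ℂ}

lemma exists_local_traceValue_bound (ha : ∀ j, ContDiffOn ℝ ∞ (a j) Ω)
    (hf : LocallyIntegrableOn f (Ω : Set (Rn n × ℝ)))
    (hg : LocallyIntegrableOn g (Ω : Set (Rn n × ℝ))) (hfg : SolvesWeakly a Ω f g)
    {K : Set (Rn n)} (hK : IsCompact K) {α γ β : ℝ} (hαγ : α < γ) (hγβ : γ < β)
    (hbox : K ×ˢ Icc α β ⊆ (Ω : Set (Rn n × ℝ))) :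
    ∃ C, 0 ≤ C ∧ ∀ φ, IsTestOn K φ →
      ContinuousOn (traceValue f φ) (Ioo α γ) ∧
      (∀ᵐ t : ℝ, t ∈ Ioo α γ → slicePairing f φ t = traceValue f φ t) ∧
      ∀ t ∈ Ioo α γ, HasTraceAt f φ t (traceValue f φ t) ∧
        ‖traceValue f φ t‖ ≤ C * testNorm 1 φ := by
  obtain ⟨C, hC, h⟩ := exists_local_representation ha hf hg hfg hK hαγ hγβ hbox
  refine ⟨C, hC, fun φ hφ => ?_⟩
  obtain ⟨R, hR, hae, hb⟩ := h φ hφ.1 hφ.2 hφ.3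
  have hT : ∀ t ∈ Ioo α γ, HasTraceAt f φ t (R t) := fun t ht =>
    hasTraceAt_of_ae_eq hae ht (hR.continuousAt (isOpen_Ioo.mem_nhds ht))
  have heq : ∀ t ∈ Ioo α γ, traceValue f φ t = R t := fun t ht => (hT t ht).traceValue_eq
  refine ⟨hR.congr heq, ?_, fun t ht => ?_⟩
  · filter_upwards [hae] with t ht htI
    rw [heq t htI, ht htI]
  · rw [heq t ht]
    exact ⟨hT t ht, hb t ht⟩

lemma hasTraceAt_traceValue (ha : ∀ j, ContDiffOn ℝ ∞ (a j) Ω)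
    (hf : LocallyIntegrableOn f (Ω : Set (Rn n × ℝ)))
    (hg : LocallyIntegrableOn g (Ω : Set (Rn n × ℝ))) (hfg : SolvesWeakly a Ω f g)
    {K : Set (Rn n)} (hK : IsCompact K) {t : ℝ} (hKt : ∀ x ∈ K, (x, t) ∈ Ω) {φ : Rn n → ℝ}
    (hφ : IsTestOn K φ) : HasTraceAt f φ t (traceValue f φ t) := by
  obtain ⟨ε, hε, hbox⟩ := exists_box_subset hK hKt
  obtain ⟨C, -, h⟩ := exists_local_traceValue_bound ha hf hg hfg hK
    (show t - ε < t + ε / 2 by linarith) (show t + ε / 2 < t + ε by linarith) hbox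
  exact ((h φ hφ).2.2 t ⟨by linarith, by linarith⟩).1

lemma traceValue_add_smul (ha : ∀ j, ContDiffOn ℝ ∞ (a j) Ω)
    (hf : LocallyIntegrableOn f (Ω : Set (Rn n × ℝ)))
    (hg : LocallyIntegrableOn g (Ω : Set (Rn n × ℝ))) (hfg : SolvesWeakly a Ω f g)
    {K : Set (Rn n)} (hK : IsCompact K) {t : ℝ} (hKt : ∀ x ∈ K, (x, t) ∈ Ω) {φ ψ : Rn n → ℝ}
    (hφ : IsTestOn K φ) (hψ : IsTestOn K ψ) (c : ℝ) :
    traceValue f (φ + c • ψ) t = traceValue f φ t + c * traceValue f ψ t :=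
  (HasTraceAt.add_smul hf hK hKt hφ hψ (hasTraceAt_traceValue ha hf hg hfg hK hKt hφ)
    (hasTraceAt_traceValue ha hf hg hfg hK hKt hψ) c).traceValue_eq

/-- For almost every `t` the slice of `f` is the trace, for all test functions on `K` at once: the
exceptional null set for a countable dense family of test functions serves for all of them, as both
sides are continuous in the `C¹` norm. -/
lemma ae_forall_slicePairing_eq_traceValue (ha : ∀ j, ContDiffOn ℝ ∞ (a j) Ω)
    (hf : LocallyIntegrableOn f (Ω : Set (Rn n × ℝ)))
    (hg : LocallyIntegrableOn g (Ω : Set (Rn n × ℝ))) (hfg : SolvesWeakly a Ω f g)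
    {K : Set (Rn n)} (hK : IsCompact K) {α β : ℝ}
    (hbox : K ×ˢ Icc α β ⊆ (Ω : Set (Rn n × ℝ))) :
    ∀ᵐ t : ℝ, t ∈ Ioo α β → ∀ φ, IsTestOn K φ → slicePairing f φ t = traceValue f φ t := by
  suffices h : ∀ γ : ℚ, ∀ᵐ t : ℝ, t ∈ Ioo α γ → (γ : ℝ) < β →
      ∀ φ, IsTestOn K φ → slicePairing f φ t = traceValue f φ t by
    filter_upwards [ae_all_iff.2 h] with t ht htI
    obtain ⟨γ, hγ, hγβ⟩ := exists_rat_btwn htI.2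
    exact ht γ ⟨htI.1, hγ⟩ hγβ
  intro γ
  by_cases hαγ : α < γ ∧ γ < β
  swap
  · exact Eventually.of_forall fun t ht hγ => (hαγ ⟨ht.1.trans ht.2, hγ⟩).elim
  obtain ⟨D, hDc, hD, hdense⟩ := exists_countable_dense_isTestOn hK
  obtain ⟨C, hC, h⟩ := exists_local_traceValue_bound ha hf hg hfg hK hαγ.1 hαγ.2 hbox
  filter_upwards [(ae_ball_iff hDc).2 fun d hd => (h d (hD d hd)).2.1,
    ae_integrableOn_slice hf hK hbox] with t htD hti htI _ φ hφ
  have htI' : t ∈ Ioo α β := ⟨htI.1, htI.2.trans hαγ.2⟩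
  have hKt : ∀ x ∈ K, (x, t) ∈ Ω := fun x hx => hbox ⟨hx, Ioo_subset_Icc_self htI'⟩
  have hF := hti htI'
  set M : ℝ := ∫ x in K, ‖f (x, t)‖ with hM
  have hM0 : 0 ≤ M := integral_nonneg fun _ => norm_nonneg _
  have hpair : ∀ ψ, IsTestOn K ψ → ‖slicePairing f ψ t‖ ≤ M * testNorm 1 ψ := by
    intro ψ hψ
    rw [slicePairing_eq_setIntegral f hψ.3, hM, ← integral_mul_const]
    refine norm_integral_le_of_norm_le (hF.norm.mul_const _) (Eventually.of_forall fun x => ?_)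
    rw [norm_mul, Complex.norm_real]
    gcongr
    refine le_trans ?_ (testNorm_mono zero_le_one ψ)
    have := norm_iteratedFDeriv_le_iSup hψ.1 hψ.2 0 x
    rw [norm_iteratedFDeriv_zero] at this
    simpa [testNorm] using this
  refine eq_of_forall_dist_le fun ε hε => ?_
  obtain ⟨d, hd, hdε⟩ := hdense φ hφ (ε / (M + C + 1)) (by positivity)
  have htest := hφ.add_smul (hD d hd) (-1)
  have e : slicePairing f φ t - traceValue f φ t =
      slicePairing f (φ + (-1 : ℝ) • d) t - traceValue f (φ + (-1 : ℝ) • d) t := by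
    rw [slicePairing_add_smul hF hφ (hD d hd),
      traceValue_add_smul ha hf hg hfg hK hKt hφ (hD d hd), htD d hd htI]
    ring
  rw [dist_eq_norm, e]
  calc _ ≤ M * testNorm 1 (φ + (-1 : ℝ) • d) + C * testNorm 1 (φ + (-1 : ℝ) • d) :=
        (norm_sub_le _ _).trans (add_le_add (hpair _ htest) ((h _ htest).2.2 t htI).2)
    _ ≤ (M + C + 1) * testNorm 1 (φ + (-1 : ℝ) • d) := by
        have := testNorm_nonneg 1 (φ + (-1 : ℝ) • d)
        nlinarith
    _ ≤ (M + C + 1) * (ε / (M + C + 1)) := by gcongr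
    _ = ε := by field_simp

theorem exists_isTrace (ha : ∀ j, ContDiffOn ℝ ∞ (a j) Ω)
    (hf : LocallyIntegrableOn f (Ω : Set (Rn n × ℝ)))
    (hg : LocallyIntegrableOn g (Ω : Set (Rn n × ℝ))) (hfg : SolvesWeakly a Ω f g) :
    ∃ F : (t : ℝ) → 𝓓'(slice Ω t, ℂ), IsTrace Ω f F := by
  have hF : ∀ t, ∃ S : 𝓓'(slice Ω t, ℂ), ∀ φ : 𝓓(slice Ω t, ℝ), S φ = traceValue f φ t := by
    intro t
    have hlin : ∀ (φ ψ : 𝓓(slice Ω t, ℝ)) (c : ℝ),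
        traceValue f (φ + c • ψ : Rn n → ℝ) t = traceValue f φ t + c * traceValue f ψ t :=
      fun φ ψ c => traceValue_add_smul ha hf hg hfg
        (K := tsupport φ ∪ tsupport ψ) (φ.hasCompactSupport.isCompact.union
          ψ.hasCompactSupport.isCompact)
        (fun x hx => union_subset φ.tsupport_subset ψ.tsupport_subset hx)
        ((isTestOn_tsupport φ).mono subset_union_left)
        ((isTestOn_tsupport ψ).mono subset_union_right) c
    refine exists_distribution (fun φ => traceValue f φ t) (fun φ ψ => ?_) (fun c φ => ?_)
      fun K hK hKt => ?_
    · have := hlin φ ψ 1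
      rw [one_smul, Complex.ofReal_one, one_mul] at this
      exact this
    · have h0 : traceValue f ((0 : 𝓓(slice Ω t, ℝ)) : Rn n → ℝ) t = 0 := by
        have h : slicePairing f ((0 : 𝓓(slice Ω t, ℝ)) : Rn n → ℝ) = fun _ => 0 := by
          ext s
          simp [slicePairing]
        have h' : HasTraceAt f ((0 : 𝓓(slice Ω t, ℝ)) : Rn n → ℝ) t 0 := by
          rw [HasTraceAt, h]
          exact tendsto_const_nhds
        exact h'.traceValue_eq
      have := hlin 0 φ c
      rw [h0, zero_add] at this
      rw [Complex.real_smul, ← this]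
      congr 1
      ext x
      simp
    · obtain ⟨ε, hε, hbox⟩ := exists_box_subset hK (t := t) (Ω := Ω) hKt
      obtain ⟨C, hC, h⟩ := exists_local_traceValue_bound ha hf hg hfg hK
        (show t - ε < t + ε / 2 by linarith) (show t + ε / 2 < t + ε by linarith) hbox
      exact ⟨1, C, hC, fun φ hφ => ((h φ ((isTestOn_tsupport φ).mono hφ)).2.2 t
        ⟨by linarith, by linarith⟩).2⟩
  choose F hF using hF
  refine ⟨F, ⟨fun φ t ht => ?_, ?_⟩⟩
  · have hK := φ.hasCompactSupport.isCompact
    obtain ⟨ε, hε, hbox⟩ := exists_box_subset hK (t := t) (Ω := Ω) ht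
    obtain ⟨C, hC, h⟩ := exists_local_traceValue_bound ha hf hg hfg hK
      (show t - ε < t + ε / 2 by linarith) (show t + ε / 2 < t + ε by linarith) hbox
    have hI : Ioo (t - ε) (t + ε / 2) ∈ 𝓝 t := Ioo_mem_nhds (by linarith) (by linarith)
    refine (((h φ (isTestOn_tsupport φ)).1.continuousAt hI).congr ?_).continuousWithinAt
    filter_upwards [hI] with s hs
    have hs' : tsupport φ ⊆ slice Ω s := fun x hx =>
      hbox ⟨hx, hs.1.le, by linarith [hs.2]⟩
    rw [pair, dif_pos hs', hF]
    rfl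
  · obtain ⟨B, hBc, hBΩ, hB⟩ := exists_countable_boxes Ω
    filter_upwards [ae_all_iff.2 fun i =>
        ae_forall_slicePairing_eq_traceValue ha hf hg hfg (hBc i) (hBΩ i),
      ae_all_iff.2 fun i => ae_integrableOn_slice hf (hBc i) (hBΩ i)] with t ht hti
    refine ⟨fun x hx => ?_, fun φ => ?_⟩
    · obtain ⟨K, hKc, hxK, hKs⟩ := exists_compact_subset (slice Ω t).isOpen hx
      obtain ⟨i, hKi, hi⟩ := hB K t hKc hKs
      exact ⟨K, mem_nhdsWithin_of_mem_nhds (mem_interior_iff_mem_nhds.1 hxK),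
        (hti i hi).mono_set hKi⟩
    · obtain ⟨i, hKi, hi⟩ := hB (tsupport φ) t φ.hasCompactSupport.isCompact φ.tsupport_subset
      rw [hF, ← ht i hi φ ((isTestOn_tsupport φ).mono hKi),
        slicePairing_eq_setIntegral f φ.tsupport_subset]

/-- Any family of traces is determined by `f` as an almost-everywhere limit; this gives uniqueness. -/
lemma IsTrace.hasTraceAt {F : (t : ℝ) → 𝓓'(slice Ω t, ℂ)} (hF : IsTrace Ω f F) (t : ℝ)
    (φ : 𝓓(slice Ω t, ℝ)) : HasTraceAt f φ t (F t φ) := by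
  have hK := φ.hasCompactSupport.isCompact
  obtain ⟨ε, hε, hbox⟩ := exists_box_subset hK (t := t) (Ω := Ω) φ.tsupport_subset
  have hI : Ioo (t - ε) (t + ε) ∈ 𝓝 t := Ioo_mem_nhds (by linarith) (by linarith)
  let φ' : 𝓓((⊤ : Opens (Rn n)), ℝ) := ⟨φ, φ.contDiff, φ.hasCompactSupport, fun _ _ => trivial⟩
  have hsl : ∀ s ∈ Ioo (t - ε) (t + ε), tsupport φ' ⊆ slice Ω s := fun s hs x hx =>
    hbox ⟨hx, hs.1.le, hs.2.le⟩
  have hc : ContinuousAt (fun s => pair (F s) φ') t :=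
    (hF.continuousOn φ').continuousAt (mem_of_superset hI hsl)
  have h := hasTraceAt_of_ae_eq (f := f) (φ := φ) (α := t - ε) (β := t + ε)
    (R := fun s => pair (F s) φ') ?_ ⟨by linarith, by linarith⟩ hc
  · have e : pair (F t) φ' = F t φ := dif_pos φ.tsupport_subset
    rwa [← e]
  · filter_upwards [hF.ae_eq] with s hs hsI
    rw [pair, dif_pos (hsl s hsI), hs.2]
    exact slicePairing_eq_setIntegral f (hsl s hsI) s

lemma IsTrace.apply_eq_traceValue {F : (t : ℝ) → 𝓓'(slice Ω t, ℂ)} (hF : IsTrace Ω f F) (t : ℝ)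
    (φ : 𝓓(slice Ω t, ℝ)) : F t φ = traceValue f φ t :=
  ((hF.hasTraceAt t φ).traceValue_eq).symm

theorem existsUnique_isTrace (ha : ∀ j, ContDiffOn ℝ ∞ (a j) Ω)
    (hf : LocallyIntegrableOn f (Ω : Set (Rn n × ℝ)))
    (hg : LocallyIntegrableOn g (Ω : Set (Rn n × ℝ))) (hfg : SolvesWeakly a Ω f g) :
    ∃! F : (t : ℝ) → 𝓓'(slice Ω t, ℂ), IsTrace Ω f F := by
  obtain ⟨F, hF⟩ := exists_isTrace ha hf hg hfg
  refine ⟨F, hF, fun G hG => funext fun t => ?_⟩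
  ext φ
  rw [hF.apply_eq_traceValue, hG.apply_eq_traceValue]

end Traces

end

/-! ### The boundary value -/

section Boundary

variable {n : ℕ} {X : Opens (Rn n)} {U : Opens (Rn n × ℝ)} {a : Fin n → Rn n × ℝ → ℂ}
  {f g : Rn n × ℝ → ℂ}

lemma exists_boundary_traceValue_bound (hXU : ∀ x ∈ X, (x, (0 : ℝ)) ∈ U)
    (ha : ∀ j, ContDiffOn ℝ ∞ (a j)
      ((X : Set (Rn n)) ×ˢ {(0 : ℝ)} ∪ (upperPart U : Set (Rn n × ℝ))))
    (hf : LocallyIntegrableOn f (upperPart U : Set (Rn n × ℝ)))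
    (hg : IntegrableOn g (upperPart U : Set (Rn n × ℝ)))
    (hfg : SolvesWeakly a (upperPart U) f g)
    {K : Set (Rn n)} (hK : IsCompact K) (hKX : K ⊆ X)
    (hgrowth : ∃ (N : ℕ) (C : ℝ), ∃ δ > 0,
      ∀ᵐ t : ℝ, t ∈ Ioo 0 δ → ∫⁻ x in K, ‖f (x, t)‖ₑ ≤ ENNReal.ofReal (C / t ^ N)) :
    ∃ (m : ℕ) (C : ℝ), ∃ δ > 0, 0 ≤ C ∧ K ×ˢ Ioo 0 δ ⊆ (upperPart U : Set (Rn n × ℝ)) ∧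
      ∀ φ, IsTestOn K φ → (∃ L, Tendsto (traceValue f φ) (𝓝[>] 0) (𝓝 L)) ∧
        ∀ t ∈ Ioo 0 δ, ‖traceValue f φ t‖ ≤ C * testNorm m φ := by
  obtain ⟨N, C₀, δ', hδ', hgr⟩ := hgrowth
  obtain ⟨ε, hε, hbox⟩ := exists_box_subset (Ω := U) (t := 0) hK fun x hx => hXU x (hKX hx)
  set δ := min (min ε δ') 1 with hδ
  have hδ0 : 0 < δ := lt_min (lt_min hε hδ') one_pos
  have hδε : δ ≤ ε := (min_le_left _ _).trans (min_le_left _ _)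
  have hδδ : δ ≤ δ' := (min_le_left _ _).trans (min_le_right _ _)
  have hpos : K ×ˢ Ioc 0 δ ⊆ (upperPart U : Set (Rn n × ℝ)) := fun z hz =>
    ⟨hbox ⟨hz.1, by linarith [hz.2.1], by linarith [hz.2.2]⟩, hz.2.1⟩
  have hclosed : K ×ˢ Icc 0 δ ⊆ (X : Set (Rn n)) ×ˢ {(0 : ℝ)} ∪
      (upperPart U : Set (Rn n × ℝ)) := by
    rintro ⟨x, t⟩ ⟨hx, ht⟩
    rcases eq_or_lt_of_le ht.1 with h | h
    · exact Or.inl ⟨hKX hx, h.symm⟩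
    · exact Or.inr (hpos ⟨hx, h, ht.2⟩)
  obtain ⟨C, hC, h⟩ := exists_boundary_representation subset_union_right
    (uniqueDiffOn_union_upperPart X U hXU) ha hf hg hfg hK hδ0 (min_le_right _ _) hpos hclosed
    (hgr.mono fun t ht htI => ht ⟨htI.1, htI.2.trans_le hδδ⟩)
  refine ⟨N + 1, C, δ / 3, by positivity, hC,
    fun z hz => hpos ⟨hz.1, hz.2.1, by linarith [hz.2.2]⟩, fun φ hφ => ?_⟩
  obtain ⟨R, L, hR, hae, hb, hL⟩ := h φ hφ.1 hφ.2 hφ.3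
  have heq : ∀ t ∈ Ioo 0 (δ / 3), traceValue f φ t = R t := fun t ht =>
    (hasTraceAt_of_ae_eq hae ht (hR.continuousAt (isOpen_Ioo.mem_nhds ht))).traceValue_eq
  refine ⟨⟨L, hL.congr' ?_⟩, fun t ht => ?_⟩
  · filter_upwards [Ioo_mem_nhdsGT (show 0 < δ / 3 by positivity)] with t ht
      using (heq t ht).symm
  · rw [heq t ht]
    exact hb t ht

/-- The bounds near the boundary and near each positive time are combined by compactness of
`[0, T]`. -/
lemma exists_uniform_traceValue_bound (hXU : ∀ x ∈ X, (x, (0 : ℝ)) ∈ U)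
    (ha : ∀ j, ContDiffOn ℝ ∞ (a j)
      ((X : Set (Rn n)) ×ˢ {(0 : ℝ)} ∪ (upperPart U : Set (Rn n × ℝ))))
    (hf : LocallyIntegrableOn f (upperPart U : Set (Rn n × ℝ)))
    (hg : IntegrableOn g (upperPart U : Set (Rn n × ℝ)))
    (hfg : SolvesWeakly a (upperPart U) f g)
    {K : Set (Rn n)} (hK : IsCompact K) (hKX : K ⊆ X)
    (hgrowth : ∃ (N : ℕ) (C : ℝ), ∃ δ > 0,
      ∀ᵐ t : ℝ, t ∈ Ioo 0 δ → ∫⁻ x in K, ‖f (x, t)‖ₑ ≤ ENNReal.ofReal (C / t ^ N))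
    {T : ℝ} (hT : ∀ t ∈ Ioc 0 T, X ≤ slice (upperPart U) t) :
    ∃ (m : ℕ) (C : ℝ), 0 ≤ C ∧ ∀ t ∈ Ioc 0 T, ∀ φ, IsTestOn K φ →
      ‖traceValue f φ t‖ ≤ C * testNorm m φ := by
  have haΩ : ∀ j, ContDiffOn ℝ ∞ (a j) (upperPart U) := fun j => (ha j).mono subset_union_right
  suffices h : ∃ (m : ℕ) (C : ℝ), 0 ≤ C ∧ ∀ t ∈ Icc 0 T, 0 < t → ∀ φ, IsTestOn K φ →
      ‖traceValue f φ t‖ ≤ C * testNorm m φ by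
    obtain ⟨m, C, hC, h⟩ := h
    exact ⟨m, C, hC, fun t ht => h t ⟨ht.1.le, ht.2⟩ ht.1⟩
  refine (isCompact_Icc (a := (0 : ℝ)) (b := T)).induction_on
    (p := fun s => ∃ (m : ℕ) (C : ℝ), 0 ≤ C ∧ ∀ t ∈ s, 0 < t → ∀ φ, IsTestOn K φ →
      ‖traceValue f φ t‖ ≤ C * testNorm m φ) ⟨0, 0, le_rfl, fun t ht => ht.elim⟩ ?_ ?_ ?_
  · rintro s s' hss ⟨m, C, hC, h⟩
    exact ⟨m, C, hC, fun t ht => h t (hss ht)⟩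
  · rintro s s' ⟨m, C, hC, h⟩ ⟨m', C', hC', h'⟩
    refine ⟨max m m', max C C', le_max_of_le_left hC, fun t ht ht0 φ hφ => ?_⟩
    have h1 := testNorm_nonneg m φ
    have h2 := testNorm_nonneg m' φ
    rcases ht with ht | ht
    · refine (h t ht ht0 φ hφ).trans ?_
      gcongr
      exacts [le_max_left _ _, testNorm_mono (le_max_left _ _) φ]
    · refine (h' t ht ht0 φ hφ).trans ?_
      gcongr
      exacts [le_max_right _ _, testNorm_mono (le_max_right _ _) φ]
  · intro t ht
    rcases eq_or_lt_of_le ht.1 with rfl | ht0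
    · obtain ⟨m, C, δ, hδ, hC, -, h⟩ := exists_boundary_traceValue_bound hXU ha hf hg hfg hK hKX
        hgrowth
      exact ⟨Iio δ, mem_nhdsWithin_of_mem_nhds (Iio_mem_nhds hδ), m, C, hC,
        fun s hs hs0 φ hφ => (h φ hφ).2 s ⟨hs0, hs⟩⟩
    · obtain ⟨ε, hε, hbox⟩ := exists_box_subset (Ω := upperPart U) (t := t) hK
        fun x hx => hT t ⟨ht0, ht.2⟩ (hKX hx)
      obtain ⟨C, hC, h⟩ := exists_local_traceValue_bound haΩ hf hg.locallyIntegrableOn hfg hK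
        (show t - ε < t + ε / 2 by linarith) (show t + ε / 2 < t + ε by linarith) hbox
      exact ⟨Ioo (t - ε) (t + ε / 2), mem_nhdsWithin_of_mem_nhds
        (Ioo_mem_nhds (by linarith) (by linarith)), 1, C, hC,
        fun s hs _ φ hφ => ((h φ hφ).2.2 s hs).2⟩

theorem exists_boundary_distribution (hXU : ∀ x ∈ X, (x, (0 : ℝ)) ∈ U)
    (ha : ∀ j, ContDiffOn ℝ ∞ (a j)
      ((X : Set (Rn n)) ×ˢ {(0 : ℝ)} ∪ (upperPart U : Set (Rn n × ℝ))))
    (hf : LocallyIntegrableOn f (upperPart U : Set (Rn n × ℝ)))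
    (hg : IntegrableOn g (upperPart U : Set (Rn n × ℝ)))
    (hfg : SolvesWeakly a (upperPart U) f g)
    (hgrowth : ∀ K : Set (Rn n), IsCompact K → K ⊆ X → ∃ (N : ℕ) (C : ℝ), ∃ δ > 0,
      ∀ᵐ t : ℝ, t ∈ Ioo 0 δ → ∫⁻ x in K, ‖f (x, t)‖ₑ ≤ ENNReal.ofReal (C / t ^ N)) :
    ∃ bf : 𝓓'(X, ℂ), ∀ φ : 𝓓(X, ℝ), Tendsto (traceValue f φ) (𝓝[>] 0) (𝓝 (bf φ)) := by
  have haΩ : ∀ j, ContDiffOn ℝ ∞ (a j) (upperPart U) := fun j => (ha j).mono subset_union_right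
  have hlim : ∀ φ : 𝓓(X, ℝ), ∃ L, Tendsto (traceValue f φ) (𝓝[>] 0) (𝓝 L) := fun φ => by
    obtain ⟨m, C, δ, -, -, -, h⟩ := exists_boundary_traceValue_bound hXU ha hf hg hfg
      φ.hasCompactSupport.isCompact φ.tsupport_subset
      (hgrowth _ φ.hasCompactSupport.isCompact φ.tsupport_subset)
    exact (h φ (isTestOn_tsupport φ)).1
  choose L hL using hlim
  have hlin : ∀ (φ ψ : 𝓓(X, ℝ)) (c : ℝ), L (φ + c • ψ) = L φ + c * L ψ := by
    intro φ ψ c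
    refine tendsto_nhds_unique (hL (φ + c • ψ))
      (((hL φ).add ((hL ψ).const_mul (c : ℂ))).congr' ?_)
    have hK : IsCompact (tsupport φ ∪ tsupport ψ) :=
      φ.hasCompactSupport.isCompact.union ψ.hasCompactSupport.isCompact
    have hKX : tsupport φ ∪ tsupport ψ ⊆ X := union_subset φ.tsupport_subset ψ.tsupport_subset
    obtain ⟨m, C, δ, hδ, -, hsub, -⟩ := exists_boundary_traceValue_bound hXU ha hf hg hfg
      hK hKX (hgrowth _ hK hKX)
    filter_upwards [Ioo_mem_nhdsGT hδ] with t ht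
    exact (traceValue_add_smul haΩ hf hg.locallyIntegrableOn hfg hK
      (fun x hx => hsub ⟨hx, ht⟩) ((isTestOn_tsupport φ).mono subset_union_left)
      ((isTestOn_tsupport ψ).mono subset_union_right) c).symm
  have hzero : L 0 = 0 := by
    have := hlin 0 0 1
    simpa using this
  obtain ⟨bf, hbf⟩ := exists_distribution L
    (fun φ ψ => by simpa using hlin φ ψ 1)
    (fun c φ => by simpa [hzero] using hlin 0 φ c)
    fun K hK hKX => by
      obtain ⟨m, C, δ, hδ, hC, -, h⟩ := exists_boundary_traceValue_bound hXU ha hf hg hfg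
        hK hKX (hgrowth K hK hKX)
      refine ⟨m, C, hC, fun φ hφ => le_of_tendsto (hL φ).norm ?_⟩
      filter_upwards [Ioo_mem_nhdsGT hδ] with t ht
        using (h φ ((isTestOn_tsupport φ).mono hφ)).2 t ht
  exact ⟨bf, fun φ => by rw [hbf]; exact hL φ⟩

end Boundary

end Trace

theorem theorem1p1 {n : ℕ} (X : Opens (Rn n)) (U : Opens (Rn n × ℝ))
    (hXU : ∀ x ∈ X, (x, (0 : ℝ)) ∈ U)
    (a : Fin n → Rn n × ℝ → ℂ)
    (ha : ∀ j, ContDiffOn ℝ ∞ (a j)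
      ((X : Set (Rn n)) ×ˢ {(0 : ℝ)} ∪ (Trace.upperPart U : Set (Rn n × ℝ))))
    (f : Rn n × ℝ → ℂ)
    (hf : LocallyIntegrableOn f (Trace.upperPart U : Set (Rn n × ℝ)))
    (hLf : ∃ g : Rn n × ℝ → ℂ, IntegrableOn g (Trace.upperPart U : Set (Rn n × ℝ)) ∧
      Trace.SolvesWeakly a (Trace.upperPart U) f g)
    (hgrowth : ∀ K : Set (Rn n), IsCompact K → K ⊆ X → ∃ (N : ℕ) (C : ℝ), ∃ δ > 0,
      ∀ᵐ t : ℝ, t ∈ Ioo 0 δ → ∫⁻ x in K, ‖f (x, t)‖ₑ ≤ ENNReal.ofReal (C / t ^ N)) :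
    (∃! F : (t : ℝ) → 𝓓'(Trace.slice (Trace.upperPart U) t, ℂ),
      Trace.IsTrace (Trace.upperPart U) f F) ∧
    ∃ bf : 𝓓'(X, ℂ), ∀ F : (t : ℝ) → 𝓓'(Trace.slice (Trace.upperPart U) t, ℂ),
      Trace.IsTrace (Trace.upperPart U) f F →
        (∀ φ : 𝓓(X, ℝ), Tendsto (fun t => Trace.pair (F t) φ) (𝓝[>] 0) (𝓝 (bf φ))) ∧
        ∀ T > 0, ∀ hT : ∀ t ∈ Ioc 0 T, X ≤ Trace.slice (Trace.upperPart U) t,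
          Trace.UniformlyBounded
            ({bf} ∪ {S : 𝓓'(X, ℂ) | ∃ (t : ℝ) (ht : t ∈ Ioc 0 T),
              S = Trace.restrict (hT t ht) (F t)}) := by
  obtain ⟨g, hg, hfg⟩ := hLf
  refine ⟨Trace.existsUnique_isTrace (fun j => (ha j).mono subset_union_right) hf
    hg.locallyIntegrableOn hfg, ?_⟩
  obtain ⟨bf, hbf⟩ := Trace.exists_boundary_distribution hXU ha hf hg hfg hgrowth
  refine ⟨bf, fun F hF => ⟨fun φ => ?_, fun T hT0 hT K hK hKX => ?_⟩⟩
  · refine (hbf φ).congr' ?_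
    obtain ⟨m, C, δ, hδ, -, hsub, -⟩ := Trace.exists_boundary_traceValue_bound hXU ha hf hg hfg
      φ.hasCompactSupport.isCompact φ.tsupport_subset
      (hgrowth _ φ.hasCompactSupport.isCompact φ.tsupport_subset)
    filter_upwards [Ioo_mem_nhdsGT hδ] with t ht
    have hφt : tsupport φ ⊆ Trace.slice (Trace.upperPart U) t := fun x hx => hsub ⟨hx, ht⟩
    rw [Trace.pair, dif_pos hφt, hF.apply_eq_traceValue]
    rfl
  · obtain ⟨m, C, -, h⟩ := Trace.exists_uniform_traceValue_bound hXU ha hf hg hfg hK hKX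
      (hgrowth K hK hKX) hT
    refine ⟨m, C, ?_⟩
    rintro S (rfl | ⟨t, ht, rfl⟩) φ hφ
    · refine le_of_tendsto (hbf φ).norm ?_
      filter_upwards [Ioc_mem_nhdsGT hT0] with t ht
        using h t ht φ ((Trace.isTestOn_tsupport φ).mono hφ)
    · have e : Trace.restrict (hT t ht) (F t) φ = Trace.traceValue f φ t := by
        change F t (TestFunction.monoCLM ℝ φ) = _
        rw [hF.apply_eq_traceValue, TestFunction.monoCLM_apply, if_pos ⟨le_rfl, hT t ht⟩]
      rw [e]
      exact h t ht φ ((Trace.isTestOn_tsupport φ).mono hφ)
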